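/- Let $I=(0,1)$, $1<\alpha<2$, $0\le r\le 1$, and let $\beta$ be determined by Condition A, i.e. $\alpha-1\le\beta\le 1$ and $$ r=\frac{\sin(\pi\beta)}{\sin(\pi(\alpha-\beta))+\sin(\pi\beta)} .$$ For $a,b>-1$ let $\rho^{(a,b)}(x)=(1-x)^a x^b$, let $P_n^{(a,b)}$ be the Jacobi polynomials, and let $\widetilde G^{(a,b)}_n$ ($n\ge 0$) be the polynomials $P_n^{(a,b)}(2x-1)$ divided by their norms in the weighted space $L^2_{\rho^{(a,b)}}(I)$. For $s\ge 0$ let $H^s_{(a,b)}(I)$ be the set of all $v\in L^2_{\rho^{(a,b)}}(I)$ with $\sum_{j\ge 0}(1+j^2)^s v_j^2<\infty$, where $v_j=\int_0^1\rho^{(a,b)}\,v\,\widetilde G^{(a,b)}_j\,dx$. Consider the problem $$ -\bigl(rD^\alpha+(1-r)D^{\alpha*}\bigr)u=f \ \text{ in } I,\qquad u(0)=u(1)=0, \tag{P}$$ $$ D^\alpha u(x)=D\,\frac{1}{\Gamma(2-\alpha)}\int_0^x\frac{Du(t)}{(x-t)^{\alpha-1}}\,dt,\qquad D^{\alpha*}u(x)=D\,\frac{1}{\Gamma(2-\alpha)}\int_x^1\frac{Du(t)}{(t-x)^{\alpha-1}}\,dt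 .$$ If $f\in H^s_{(\beta,\alpha-\beta)}(I)$ with $s>(1-\alpha)+\max\{\alpha-\beta,\beta\}$ (so that $s>0$), then the solution $u$ of (P) exists, is unique, and is continuous on $I$, indeed on $[0,1]$. Here $u$ solves (P) if it is absolutely continuous on $[0,1]$, $u(0)=u(1)=0$, and the equation holds with the outer $D$ taken in the sense of distributions on $I$. This $u$ is also, up to equality almost everywhere, the only very weak solution, so every very weak solution has a continuous representative. A function $w\in L^1(I)$ is a very weak solution if $\varepsilon^{-1}\int_0^\varepsilon|w|\,dx\to 0$ and $\varepsilon^{-1}\int_{1-\varepsilon}^1|w|\,dx\to 0$ as $\varepsilon\to 0^+$, and for all $\psi\in C_c^\infty(I)$ $$-\int_0^1\frac{1}{\Gamma(2-\alpha)}\Bigl(r\int_0^x\frac{w(t)}{(x-t)^{\alpha-1}}dt+(1-r)\int_x^1\frac{w(t)}{(t-x)^{\alpha-1}}dt\Bigr)\psi''(x)\,dx=\int_0^1 f\psi\,dx .$$ -/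

import Mathlib

open MeasureTheory Set Filter Topology

noncomputable section

namespace FracDiff

/-- The weight `ρ^{(a,b)}(x) = (1 - x)^a x^b`, used on the interval `(0,1)`. -/
def rho (a b x : ℝ) : ℝ := (1 - x) ^ a * x ^ b

/-- The Jacobi polynomial `P_n^{(a,b)}(t)` on `(-1,1)`; `Ring.choose` is the generalised binomial
coefficient with a real upper entry. -/
def jacobiP (a b : ℝ) (n : ℕ) (t : ℝ) : ℝ :=
  ∑ m ∈ Finset.range (n + 1),
    (1 / 2 ^ n * (Ring.choose ((n : ℝ) + a) m * Ring.choose ((n : ℝ) + b) (n - m))) *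
      ((t - 1) ^ (n - m) * (t + 1) ^ m)

/-- The Jacobi polynomial transplanted to `(0,1)`: `G_n^{(a,b)}(x) = P_n^{(a,b)}(2x - 1)`. -/
def jacobiG (a b : ℝ) (n : ℕ) (x : ℝ) : ℝ := jacobiP a b n (2 * x - 1)

/-- The norm of `G_n^{(a,b)}` in the `ρ^{(a,b)}`-weighted space `L²(0,1)`. -/
def normG (a b : ℝ) (n : ℕ) : ℝ :=
  Real.sqrt (∫ x in (0 : ℝ)..1, rho a b x * jacobiG a b n x ^ 2)

/-- The orthonormal Jacobi polynomial on `(0,1)`. -/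
def jacobiGn (a b : ℝ) (n : ℕ) (x : ℝ) : ℝ := jacobiG a b n x / normG a b n

/-- Membership in the weighted space `L²_{ρ^{(a,b)}}(0,1)`. -/
def MemWeightedL2 (a b : ℝ) (v : ℝ → ℝ) : Prop :=
  AEStronglyMeasurable v (volume.restrict (Ioo (0 : ℝ) 1)) ∧
    IntegrableOn (fun x => rho a b x * v x ^ 2) (Ioo (0 : ℝ) 1)

/-- The Jacobi coefficient `v_j` of `v`. -/
def jacobiCoeff (a b : ℝ) (v : ℝ → ℝ) (j : ℕ) : ℝ :=
  ∫ x in (0 : ℝ)..1, rho a b x * v x * jacobiGn a b j x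

/-- Membership in the weighted Sobolev space `H^s_{(a,b)}(0,1)`, for an order `s ≥ 0` and weights
`a, b > -1`. -/
def MemH (s a b : ℝ) (v : ℝ → ℝ) : Prop :=
  MemWeightedL2 a b v ∧
    Summable (fun j : ℕ => (1 + (j : ℝ) ^ 2) ^ s * jacobiCoeff a b v j ^ 2)

/-- Condition A: `β ∈ [α - 1, 1]` is the parameter attached to `α` and `r`. -/
def ConditionA (α r β : ℝ) : Prop :=
  α - 1 ≤ β ∧ β ≤ 1 ∧
    r = Real.sin (Real.pi * β) / (Real.sin (Real.pi * (α - β)) + Real.sin (Real.pi * β))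

/-- The left fractional integral of order `2 - α`:
`x ↦ 1/Γ(2-α) ∫_0^x (x-s)^{-(α-1)} g(s) ds`. -/
def leftInt (α : ℝ) (g : ℝ → ℝ) (x : ℝ) : ℝ :=
  1 / Real.Gamma (2 - α) * ∫ s in (0 : ℝ)..x, 1 / (x - s) ^ (α - 1) * g s

/-- The right fractional integral of order `2 - α`:
`x ↦ 1/Γ(2-α) ∫_x^1 (s-x)^{-(α-1)} g(s) ds`. -/
def rightInt (α : ℝ) (g : ℝ → ℝ) (x : ℝ) : ℝ :=
  1 / Real.Gamma (2 - α) * ∫ s in x..(1 : ℝ), 1 / (s - x) ^ (α - 1) * g s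

/-- `r` times the left plus `1 - r` times the right fractional integral of order `2 - α`. Thus
`r D^α u + (1 - r) D^{α*} u` is the derivative of `mixedInt α r (D u)`. -/
def mixedInt (α r : ℝ) (g : ℝ → ℝ) (x : ℝ) : ℝ :=
  r * leftInt α g x + (1 - r) * rightInt α g x

/-- Test functions: smooth functions with compact support inside `(0,1)`. -/
def IsTest (ψ : ℝ → ℝ) : Prop :=
  ContDiff ℝ ((⊤ : ℕ∞) : WithTop ℕ∞) ψ ∧ tsupport ψ ⊆ Ioo (0 : ℝ) 1

/-- `u` solves `-(r D^α + (1 - r) D^{α*}) u = f` on `(0,1)`, `u(0) = u(1) = 0`. The inner derivative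
`D u`, which stands under the fractional integrals, is the derivative of the absolutely continuous
function `u`; the outer derivative is taken in the sense of distributions on `(0,1)`. -/
def IsSolution (α r : ℝ) (f u : ℝ → ℝ) : Prop :=
  AbsolutelyContinuousOnInterval u 0 1 ∧ u 0 = 0 ∧ u 1 = 0 ∧
    ∀ ψ : ℝ → ℝ, IsTest ψ →
      ∫ x in (0 : ℝ)..1, mixedInt α r (deriv u) x * deriv ψ x =
        ∫ x in (0 : ℝ)..1, f x * ψ x

/-- Very weak form of the same boundary value problem, for a function `w` that is merely integrable.
Zero boundary values are imposed in the mean. For zero boundary values `D` commutes with the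
fractional integrals, and both derivatives are moved to the test function. Neither continuity nor
differentiability of `w` is asked for. -/
def IsWeakSolution (α r : ℝ) (f w : ℝ → ℝ) : Prop :=
  IntegrableOn w (Ioo (0 : ℝ) 1) ∧
    Tendsto (fun ε : ℝ => 1 / ε * ∫ x in (0 : ℝ)..ε, |w x|) (𝓝[>] 0) (𝓝 0) ∧
    Tendsto (fun ε : ℝ => 1 / ε * ∫ x in (1 - ε)..(1 : ℝ), |w x|) (𝓝[>] 0) (𝓝 0) ∧
    ∀ ψ : ℝ → ℝ, IsTest ψ →
      -∫ x in (0 : ℝ)..1, mixedInt α r w x * deriv (deriv ψ) x =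
        ∫ x in (0 : ℝ)..1, f x * ψ x

end FracDiff

end

noncomputable section

namespace FracDiff

/-! Let K be the integral operator on (0,1) with kernel `kern` (`kint`); the equation reads -(K u')'
= f. Put a = α - β, b = β and φ = (1-x)^(a-1) x^(b-1). Condition A is, by the reflection formula for
Γ, the balance under which K φ is a positive constant (`ConditionA.balanced`, `kint_rho_eq_const`).
Since z times the kernel is a multiple of the primitive of the kernel, induction on the degree shows
that K sends φ times a polynomial to a polynomial of no larger degree, with positive diagonal
entries (`exists_linearMap_kint`). The transpose of K has 1 - r in place of r, and does the same for
the mirrored weight φ* = (1-x)^(b-1) x^(a-1).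

Existence. Put ρ = (1-x)^b x^a and test the equation for g = u' with ρ q, q a polynomial. As (ρ q)'
is φ* times a polynomial, moving K across gives ∫ g (B q) = ∫ ρ f q for a linear operator B on
polynomials. B has a formal adjoint A between the L² spaces of φ and ρ, and A B is triangular in the
degree with diagonal entries κ n bounded below by a positive constant. Orthogonal polynomials then
give c ‖q‖² ≤ ‖B q‖² (`mul_norm_sq_le_of_triangular`), and Hahn-Banach with Riesz gives g
(`exists_inner_eq_of_lower_bound`). A multiple of φ corrects the mean of g to zero without affecting
the equation, and u is the primitive of g. Weierstrass approximation passes from polynomials to all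
test functions (`integral_mul_deriv_eq_of_rhoDeriv`).

Uniqueness. For the difference v of two very weak solutions, K v is affine. K is injective on L¹,
because its transpose reaches every polynomial, so v = φ d with d affine. Both exponents of φ are
nonpositive, hence φ ≥ 1 and the mean boundary conditions force d(0) = d(1) = 0, so d = 0
(`IsWeakSolution.ae_eq`). Every solution is a very weak solution, and solutions are absolutely
continuous, so uniqueness and continuity hold for them too. -/

/-- Lebesgue measure on the unit interval. -/
abbrev unitVol : Measure ℝ := volume.restrict (Ioo (0 : ℝ) 1)

/-! ### The kernel, its primitive, and the integral operator -/

/-- The convolution kernel of `mixedInt`. -/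
def kern (α r z : ℝ) : ℝ :=
  1 / Real.Gamma (2 - α) * if 0 < z then r * z ^ (1 - α) else (1 - r) * (-z) ^ (1 - α)

/-- The primitive of `kern` that vanishes at `0`. -/
def kernPrim (α r z : ℝ) : ℝ :=
  1 / Real.Gamma (2 - α) / (2 - α) *
    (r * (max z 0) ^ (2 - α) - (1 - r) * (max (-z) 0) ^ (2 - α))

/-- `mixedInt` as an integral over the whole unit interval. -/
def kint (α r : ℝ) (g : ℝ → ℝ) (x : ℝ) : ℝ := ∫ t, kern α r (x - t) * g t ∂unitVol

lemma intervalIntegral_eq_unitVol (g : ℝ → ℝ) : ∫ x in (0 : ℝ)..1, g x = ∫ x, g x ∂unitVol := by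
  rw [intervalIntegral.integral_of_le zero_le_one, integral_Ioc_eq_integral_Ioo]

lemma intervalIntegrable_iff_unitVol {g : ℝ → ℝ} :
    IntervalIntegrable g volume 0 1 ↔ Integrable g unitVol := by
  rw [intervalIntegrable_iff_integrableOn_Ioo_of_le zero_le_one]; rfl

lemma kern_nonneg {α r : ℝ} (hα₂ : α < 2) (hr₀ : 0 ≤ r) (hr₁ : r ≤ 1) (z : ℝ) :
    0 ≤ kern α r z := by
  have : 0 < Real.Gamma (2 - α) := Real.Gamma_pos_of_pos (by linarith)
  unfold kern
  split_ifs with h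
  · have := Real.rpow_nonneg h.le (1 - α)
    positivity
  · have := Real.rpow_nonneg (show 0 ≤ -z by linarith) (1 - α)
    have : 0 ≤ 1 - r := by linarith
    positivity

lemma kern_zero {α r : ℝ} (hα₁ : 1 < α) : kern α r 0 = 0 := by
  simp [kern, Real.zero_rpow (show 1 - α ≠ 0 by linarith)]

/-- Transposing the operator reflects the kernel, hence exchanges r and 1 - r; this is the source of
all duality below. At z = 0 it relies on the convention that 0 has real power 0 for a nonzero
exponent. -/
lemma kern_one_sub {α : ℝ} (hα₁ : 1 < α) (r z : ℝ) : kern α (1 - r) z = kern α r (-z) := by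
  rcases lt_trichotomy z 0 with h | h | h
  · simp [kern, h.not_gt, h]
  · subst h; simp [kern_zero hα₁]
  · simp [kern, h.not_gt, h]

/-- Euler's identity for a homogeneous kernel. It turns multiplication by t under the integral, via
t = x - (x - t), into multiplication by x outside minus an integrated kernel. -/
lemma mul_kern {α : ℝ} (hα₁ : 1 < α) (hα₂ : α < 2) (r z : ℝ) :
    z * kern α r z = (2 - α) * kernPrim α r z := by
  have h2 : (2 - α) ≠ 0 := by linarith
  have hg : Real.Gamma (2 - α) ≠ 0 := (Real.Gamma_pos_of_pos (by linarith)).ne'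
  rcases lt_trichotomy z 0 with h | h | h
  · have e : (-z) ^ (2 - α) = (-z) * (-z) ^ (1 - α) := by
      rw [← Real.rpow_one_add' (by linarith) (by linarith)]; congr 1; ring
    simp only [kern, kernPrim, h.not_gt, if_false, max_eq_right h.le,
      max_eq_left (show (0 : ℝ) ≤ -z by linarith), e, Real.zero_rpow h2]
    field_simp
    ring
  · subst h; simp [kern_zero hα₁, kernPrim, Real.zero_rpow h2]
  · have e : z ^ (2 - α) = z * z ^ (1 - α) := by
      rw [← Real.rpow_one_add' (by linarith) (by linarith)]; congr 1; ring
    simp only [kern, kernPrim, h, if_true, max_eq_left h.le,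
      max_eq_right (show -z ≤ (0 : ℝ) by linarith), e, Real.zero_rpow h2]
    field_simp
    ring

lemma continuous_kernPrim {α : ℝ} (hα₂ : α < 2) (r : ℝ) : Continuous (kernPrim α r) := by
  unfold kernPrim
  have h : ∀ x : ℝ, x ≠ 0 ∨ 0 ≤ 2 - α := fun _ => Or.inr (by linarith)
  have h1 : Continuous fun z : ℝ => (max z 0) ^ (2 - α) :=
    (continuous_id.max continuous_const).rpow_const fun _ => h _
  have h2 : Continuous fun z : ℝ => (max (-z) 0) ^ (2 - α) :=
    (continuous_neg.max continuous_const).rpow_const fun _ => h _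
  fun_prop

lemma hasDerivAt_kernPrim {α : ℝ} (hα₂ : α < 2) (r : ℝ) {z : ℝ} (hz : z ≠ 0) :
    HasDerivAt (kernPrim α r) (kern α r z) z := by
  have h2 : (2 - α) ≠ 0 := by linarith
  have hg : Real.Gamma (2 - α) ≠ 0 := (Real.Gamma_pos_of_pos (by linarith)).ne'
  rcases lt_or_gt_of_ne hz with h | h
  · have := ((((hasDerivAt_id z).fun_neg).rpow_const (p := 2 - α)
      (Or.inl (by simpa using hz))).const_mul (1 - r)).const_mul
      (-(1 / Real.Gamma (2 - α) / (2 - α)))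
    refine (this.congr_of_eventuallyEq ?_).congr_deriv ?_
    · filter_upwards [gt_mem_nhds h] with y hy
      simp [kernPrim, max_eq_right hy.le, max_eq_left (show (0 : ℝ) ≤ -y by linarith),
        Real.zero_rpow h2]
    · simp only [kern, h.not_gt, if_false, show 2 - α - 1 = 1 - α by ring, id]
      field_simp
  · have := (((hasDerivAt_id z).rpow_const (p := 2 - α) (Or.inl hz)).const_mul r).const_mul
      (1 / Real.Gamma (2 - α) / (2 - α))
    refine (this.congr_of_eventuallyEq ?_).congr_deriv ?_
    · filter_upwards [lt_mem_nhds h] with y hy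
      simp [kernPrim, max_eq_left hy.le, max_eq_right (show -y ≤ (0 : ℝ) by linarith),
        Real.zero_rpow h2]
    · simp only [kern, h, if_true, show 2 - α - 1 = 1 - α by ring, id]
      field_simp

lemma intervalIntegrable_kern {α : ℝ} (hα₁ : 1 < α) (hα₂ : α < 2) (r p q : ℝ) :
    IntervalIntegrable (kern α r) volume p q := by
  have pos : ∀ q : ℝ, 0 ≤ q → ∀ r : ℝ, IntervalIntegrable (kern α r) volume 0 q := by
    intro q hq r
    have h : IntervalIntegrable (fun z : ℝ => 1 / Real.Gamma (2 - α) * (r * z ^ (1 - α)))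
        volume 0 q :=
      ((intervalIntegral.intervalIntegrable_rpow' (by linarith)).const_mul _).const_mul _
    refine h.congr fun z hz => ?_
    rw [uIoc_of_le hq] at hz
    simp [kern, hz.1]
  have all : ∀ q : ℝ, IntervalIntegrable (kern α r) volume 0 q := by
    intro q
    rcases le_total 0 q with h | h
    · exact pos q h r
    · refine (IntervalIntegrable.iff_comp_neg (by simp)).2 ?_
      rw [neg_zero, ← funext (kern_one_sub hα₁ r)]
      exact pos (-q) (by linarith) (1 - r)
  exact (all p).symm.trans (all q)

lemma integral_kern {α : ℝ} (hα₁ : 1 < α) (hα₂ : α < 2) (r p q : ℝ) :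
    ∫ z in p..q, kern α r z = kernPrim α r q - kernPrim α r p := by
  refine integral_eq_of_hasDerivAt_off_countable _ _ (s := {0}) (countable_singleton _)
    (continuous_kernPrim hα₂ r).continuousOn (fun z hz => hasDerivAt_kernPrim hα₂ r ?_)
    (intervalIntegrable_kern hα₁ hα₂ r p q)
  simpa using hz.2

/-- Extended by zero, this is the integrand of a convolution of two L¹ functions: x - t stays in
(-1,1), where the kernel is integrable. It gives Fubini, and convergence of `kint` for almost every
x. -/
lemma integrable_kern_mul_prod {α : ℝ} (hα₁ : 1 < α) (hα₂ : α < 2) (r : ℝ) {g : ℝ → ℝ}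
    (hg : Integrable g unitVol) :
    Integrable (fun p : ℝ × ℝ => kern α r (p.1 - p.2) * g p.2) (unitVol.prod unitVol) := by
  have h1 : Integrable ((Ioc (-1 : ℝ) 1).indicator (kern α r)) :=
    ((intervalIntegrable_kern hα₁ hα₂ r (-1) 1).1).integrable_indicator measurableSet_Ioc
  have h2 : Integrable ((Ioo (0 : ℝ) 1).indicator g) :=
    IntegrableOn.integrable_indicator hg measurableSet_Ioo
  have h := (Integrable.convolution_integrand (ContinuousLinearMap.mul ℝ ℝ) h2 h1).integrableOn
    (s := Ioo (0 : ℝ) 1 ×ˢ Ioo (0 : ℝ) 1)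
  rw [Measure.prod_restrict]
  refine h.congr_fun (fun p hp => ?_) (measurableSet_Ioo.prod measurableSet_Ioo)
  obtain ⟨⟨h1, h2⟩, h3, h4⟩ := hp
  have e1 : p.1 - p.2 ∈ Ioc (-1 : ℝ) 1 := ⟨by linarith, by linarith⟩
  have e2 : p.2 ∈ Ioo (0 : ℝ) 1 := ⟨h3, h4⟩
  simp [indicator_of_mem e1, indicator_of_mem e2, mul_comm]

lemma ae_integrable_kern_mul {α : ℝ} (hα₁ : 1 < α) (hα₂ : α < 2) (r : ℝ) {g : ℝ → ℝ}
    (hg : Integrable g unitVol) :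
    ∀ᵐ x ∂unitVol, Integrable (fun t => kern α r (x - t) * g t) unitVol :=
  (integrable_kern_mul_prod hα₁ hα₂ r hg).prod_right_ae

lemma integrable_kint {α : ℝ} (hα₁ : 1 < α) (hα₂ : α < 2) (r : ℝ) {g : ℝ → ℝ}
    (hg : Integrable g unitVol) : Integrable (kint α r g) unitVol :=
  (integrable_kern_mul_prod hα₁ hα₂ r hg).integral_prod_left

lemma kint_congr_ae (α r : ℝ) {g h : ℝ → ℝ} (hgh : g =ᵐ[unitVol] h) (x : ℝ) :
    kint α r g x = kint α r h x := by
  refine integral_congr_ae ?_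
  filter_upwards [hgh] with t ht
  rw [ht]

lemma kint_add_ae {α : ℝ} (hα₁ : 1 < α) (hα₂ : α < 2) (r : ℝ) {g h : ℝ → ℝ}
    (hg : Integrable g unitVol) (hh : Integrable h unitVol) :
    kint α r (fun t => g t + h t) =ᵐ[unitVol] fun x => kint α r g x + kint α r h x := by
  filter_upwards [ae_integrable_kern_mul hα₁ hα₂ r hg, ae_integrable_kern_mul hα₁ hα₂ r hh]
    with x h1 h2
  simp only [kint, mul_add]
  exact integral_add h1 h2

lemma kint_const_mul (α r c : ℝ) (g : ℝ → ℝ) (x : ℝ) :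
    kint α r (fun t => c * g t) x = c * kint α r g x := by
  simp only [kint, mul_left_comm _ c]
  exact integral_const_mul _ _

/-- The kernel operators with parameters `r` and `1 - r` are adjoint to each other. -/
lemma integral_kint_mul {α : ℝ} (hα₁ : 1 < α) (r : ℝ) {g φ : ℝ → ℝ}
    (h : Integrable (fun p : ℝ × ℝ => kern α r (p.1 - p.2) * g p.2 * φ p.1)
      (unitVol.prod unitVol)) :
    ∫ x, kint α r g x * φ x ∂unitVol = ∫ t, g t * kint α (1 - r) φ t ∂unitVol := by
  have := integral_integral_swap (f := fun x t => kern α r (x - t) * g t * φ x) h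
  simp only [kint, ← integral_mul_const, ← integral_const_mul]
  rw [this]
  refine integral_congr_ae (.of_forall fun t => integral_congr_ae (.of_forall fun x => ?_))
  simp only [kern_one_sub hα₁, neg_sub]
  ring

/-- The integrability hypothesis allows the integral to be split at x; without it the two sides
could differ through the default value 0 of a divergent integral. -/
lemma mixedInt_eq_kint {α r x : ℝ} (hα₁ : 1 < α) {g : ℝ → ℝ} (hx : x ∈ Ioo (0 : ℝ) 1)
    (h : Integrable (fun t => kern α r (x - t) * g t) unitVol) :
    mixedInt α r g x = kint α r g x := by
  have h0 : ∀ y : ℝ, 0 ≤ y → 1 / y ^ (α - 1) = y ^ (1 - α) := fun y hy => by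
    rw [one_div, ← Real.rpow_neg hy, neg_sub]
  have h := intervalIntegrable_iff_unitVol.2 h
  rw [kint, ← intervalIntegral_eq_unitVol, ← intervalIntegral.integral_add_adjacent_intervals
    (h.mono_set (c := 0) (d := x) ?_) (h.mono_set (c := x) (d := 1) ?_)]
  · simp only [mixedInt, leftInt, rightInt, ← intervalIntegral.integral_const_mul]
    congr 1
    · refine intervalIntegral.integral_congr fun t ht => ?_
      rw [uIcc_of_le hx.1.le] at ht
      rcases ht.2.eq_or_lt with rfl | h'
      · simp [kern_zero hα₁, Real.zero_rpow (show α - 1 ≠ 0 by linarith)]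
      · simp only [kern, h0 _ (sub_nonneg.2 h'.le), if_pos (sub_pos.2 h')]
        ring
    · refine intervalIntegral.integral_congr fun t ht => ?_
      rw [uIcc_of_le hx.2.le] at ht
      simp only [kern, h0 _ (sub_nonneg.2 ht.1), if_neg (show ¬ 0 < x - t by linarith [ht.1]),
        neg_sub]
      ring
  · rw [uIcc_of_le hx.1.le, uIcc_of_le zero_le_one]; exact Icc_subset_Icc_right hx.2.le
  · rw [uIcc_of_le hx.2.le, uIcc_of_le zero_le_one]; exact Icc_subset_Icc_left hx.1.le

lemma mixedInt_ae_eq_kint {α : ℝ} (hα₁ : 1 < α) (hα₂ : α < 2) (r : ℝ) {g : ℝ → ℝ}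
    (hg : Integrable g unitVol) : mixedInt α r g =ᵐ[unitVol] kint α r g := by
  filter_upwards [ae_integrable_kern_mul hα₁ hα₂ r hg, ae_restrict_mem measurableSet_Ioo]
    with x h hx using mixedInt_eq_kint hα₁ hx h

lemma integrable_kernPrim_mul {α : ℝ} (hα₂ : α < 2) (r x : ℝ) {g : ℝ → ℝ}
    (hg : Integrable g unitVol) :
    Integrable (fun t => kernPrim α r (x - t) * g t) unitVol := by
  have h := intervalIntegrable_iff_unitVol.2 hg
  exact intervalIntegrable_iff_unitVol.1 (h.continuousOn_mul
    ((continuous_kernPrim hα₂ r).comp (continuous_const.sub continuous_id)).continuousOn)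

/-- Integrating `kint` replaces the kernel by its primitive. -/
lemma integral_kint {α : ℝ} (hα₁ : 1 < α) (hα₂ : α < 2) (r : ℝ) {g : ℝ → ℝ}
    (hg : Integrable g unitVol) {x : ℝ} (hx : x ∈ Icc (0 : ℝ) 1) :
    ∫ y in (0 : ℝ)..x, kint α r g y =
      ∫ t, kernPrim α r (x - t) * g t ∂unitVol - ∫ t, kernPrim α r (0 - t) * g t ∂unitVol := by
  rw [intervalIntegral.integral_of_le hx.1, integral_Ioc_eq_integral_Ioo]
  have h : Integrable (fun p : ℝ × ℝ => kern α r (p.1 - p.2) * g p.2)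
      ((volume.restrict (Ioo 0 x)).prod unitVol) :=
    (integrable_kern_mul_prod hα₁ hα₂ r hg).mono_measure
      (Measure.prod_mono (Measure.restrict_mono (Ioo_subset_Ioo_right hx.2) le_rfl) le_rfl)
  simp only [kint]
  rw [integral_integral_swap h, ← integral_sub (integrable_kernPrim_mul hα₂ r x hg)
    (integrable_kernPrim_mul hα₂ r 0 hg)]
  refine integral_congr_ae (.of_forall fun t => ?_)
  simp only
  rw [integral_mul_const, ← integral_Ioc_eq_integral_Ioo, ← intervalIntegral.integral_of_le hx.1,
    intervalIntegral.integral_comp_sub_right (kern α r), integral_kern hα₁ hα₂]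
  ring

/-! ### From the equation to its very weak form -/

/-- For an absolutely continuous function with zero boundary values, the derivative commutes with
the fractional integrals. -/
lemma kint_eq_integral_kernPrim_mul {α : ℝ} (hα₁ : 1 < α) (hα₂ : α < 2) (r : ℝ) {u : ℝ → ℝ}
    (hu : AbsolutelyContinuousOnInterval u 0 1) (hu0 : u 0 = 0) (hu1 : u 1 = 0) (x : ℝ) :
    kint α r u x = ∫ t, kernPrim α r (x - t) * deriv u t ∂unitVol := by
  have hk : IntervalIntegrable (fun t => kern α r (x - t)) volume 0 1 := by
    have := (intervalIntegrable_kern hα₁ hα₂ r (x - 0) (x - 1)).comp_sub_left x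
    simpa using this
  have hv : ∀ t, ∫ s in (0 : ℝ)..t, kern α r (x - s) =
      kernPrim α r x - kernPrim α r (x - t) := fun t => by
    rw [intervalIntegral.integral_comp_sub_left (kern α r), integral_kern hα₁ hα₂, sub_zero]
  -- As a primitive in t of the reflected kernel, `v` serves for integration by parts against u. Its
  -- constant part `kernPrim α r x` drops out because u' has integral u(1) - u(0) = 0.
  set v : ℝ → ℝ := fun t => ∫ s in (0 : ℝ)..t, kern α r (x - s)
  have hvac : AbsolutelyContinuousOnInterval v 0 1 :=
    hk.absolutelyContinuousOnInterval_intervalIntegral (by simp)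
  have key := hu.integral_mul_deriv_eq_deriv_mul hvac
  have hdu := hu.intervalIntegrable_deriv
  have e1 : ∫ t in (0 : ℝ)..1, u t * deriv v t = kint α r u x := by
    rw [kint, ← intervalIntegral_eq_unitVol]
    refine intervalIntegral.integral_congr_ae ?_
    filter_upwards [hk.ae_hasDerivAt_integral] with t ht htm
    rw [(ht (uIoc_subset_uIcc htm) 0 (by simp)).deriv, mul_comm]
  have e2 : ∫ t in (0 : ℝ)..1, deriv u t * v t =
      - ∫ t, kernPrim α r (x - t) * deriv u t ∂unitVol := by
    simp only [v, hv, mul_sub]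
    rw [intervalIntegral.integral_sub (hdu.mul_const _), intervalIntegral.integral_mul_const,
      hu.integral_deriv_eq_sub, hu0, hu1, intervalIntegral_eq_unitVol]
    · simp [mul_comm]
    · exact hdu.mul_continuousOn
        ((continuous_kernPrim hα₂ r).comp (continuous_const.sub continuous_id)).continuousOn
  rw [e1, e2, hu0, hu1] at key
  linarith

lemma integrable_deriv_unitVol {u : ℝ → ℝ}
    (hu : AbsolutelyContinuousOnInterval u 0 1) : Integrable (deriv u) unitVol :=
  intervalIntegrable_iff_unitVol.1 hu.intervalIntegrable_deriv

lemma IsTest.deriv {ψ : ℝ → ℝ} (hψ : IsTest ψ) : IsTest (deriv ψ) :=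
  ⟨(contDiff_infty_iff_deriv.1 hψ.1).2, (closure_mono support_deriv_subset).trans
    (by rw [(isClosed_tsupport ψ).closure_eq]; exact hψ.2)⟩

lemma IsTest.eq_zero {ψ : ℝ → ℝ} (hψ : IsTest ψ) {x : ℝ} (hx : x ∉ Ioo (0 : ℝ) 1) : ψ x = 0 :=
  image_eq_zero_of_notMem_tsupport fun h => hx (hψ.2 h)

lemma IsTest.continuous {ψ : ℝ → ℝ} (hψ : IsTest ψ) : Continuous ψ := hψ.1.continuous

lemma IsTest.absolutelyContinuous {ψ : ℝ → ℝ} (hψ : IsTest ψ) :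
    AbsolutelyContinuousOnInterval ψ 0 1 :=
  ContDiffOn.absolutelyContinuousOnInterval (hψ.1.contDiffOn.of_le (by simp))

lemma IsTest.integrable_mul {ψ : ℝ → ℝ} (hψ : IsTest ψ) {h : ℝ → ℝ} (hh : Integrable h unitVol) :
    Integrable (fun x => h x * ψ x) unitVol :=
  intervalIntegrable_iff_unitVol.1
    ((intervalIntegrable_iff_unitVol.2 hh).mul_continuousOn hψ.continuous.continuousOn)

/-- Passing from the equation for `u'` to the very weak form of the equation for `u`. -/
lemma integral_mixedInt_mul_deriv_deriv {α : ℝ} (hα₁ : 1 < α) (hα₂ : α < 2) (r : ℝ) {u ψ : ℝ → ℝ}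
    (hu : AbsolutelyContinuousOnInterval u 0 1) (hu0 : u 0 = 0) (hu1 : u 1 = 0) (hψ : IsTest ψ) :
    -∫ x in (0 : ℝ)..1, mixedInt α r u x * deriv (deriv ψ) x =
      ∫ x in (0 : ℝ)..1, mixedInt α r (deriv u) x * deriv ψ x := by
  have hd := integrable_deriv_unitVol hu
  have hui : Integrable u unitVol := intervalIntegrable_iff_unitVol.1
    (ContinuousOn.intervalIntegrable hu.continuousOn)
  have hki := intervalIntegrable_iff_unitVol.2 (integrable_kint hα₁ hα₂ r hd)
  -- The constant of integration: K u = `v` + `c` almost everywhere on (0,1), and `c` disappears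
  -- since ψ'' has integral zero.
  set c := ∫ t, kernPrim α r (0 - t) * deriv u t ∂unitVol
  set v : ℝ → ℝ := fun x => ∫ y in (0 : ℝ)..x, kint α r (deriv u) y
  have hvac : AbsolutelyContinuousOnInterval v 0 1 :=
    hki.absolutelyContinuousOnInterval_intervalIntegral (by simp)
  have key := hvac.integral_mul_deriv_eq_deriv_mul hψ.deriv.absolutelyContinuous
  rw [hψ.deriv.eq_zero (x := 0) (by simp), hψ.deriv.eq_zero (x := 1) (by simp)] at key
  have hψ2 := hψ.deriv.absolutelyContinuous.integral_deriv_eq_sub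
  rw [hψ.deriv.eq_zero (x := 0) (by simp), hψ.deriv.eq_zero (x := 1) (by simp)] at hψ2
  have hψ2i := hψ.deriv.absolutelyContinuous.intervalIntegrable_deriv
  have e1 : ∫ x in (0 : ℝ)..1, mixedInt α r u x * deriv (deriv ψ) x =
      ∫ x in (0 : ℝ)..1, v x * deriv (deriv ψ) x := by
    have : ∫ x in (0 : ℝ)..1, mixedInt α r u x * deriv (deriv ψ) x =
        ∫ x in (0 : ℝ)..1, (v x * deriv (deriv ψ) x + c * deriv (deriv ψ) x) := by
      simp only [intervalIntegral_eq_unitVol]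
      refine integral_congr_ae ?_
      filter_upwards [mixedInt_ae_eq_kint hα₁ hα₂ r hui, ae_restrict_mem measurableSet_Ioo]
        with x h hx
      rw [h, kint_eq_integral_kernPrim_mul hα₁ hα₂ r hu hu0 hu1]
      simp only [v]
      rw [integral_kint hα₁ hα₂ r hd (Ioo_subset_Icc_self hx)]
      ring
    rw [this, intervalIntegral.integral_add (hψ2i.continuousOn_mul hvac.continuousOn)
      (hψ2i.const_mul c), intervalIntegral.integral_const_mul, hψ2]
    ring
  have e2 : ∫ x in (0 : ℝ)..1, mixedInt α r (deriv u) x * deriv ψ x =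
      ∫ x in (0 : ℝ)..1, deriv v x * deriv ψ x := by
    simp only [intervalIntegral_eq_unitVol]
    refine integral_congr_ae ?_
    filter_upwards [mixedInt_ae_eq_kint hα₁ hα₂ r hd, ae_restrict_mem measurableSet_Ioo,
      ae_restrict_of_ae hki.ae_hasDerivAt_integral] with x h hx h'
    rw [h, (h' (by rw [uIcc_of_le zero_le_one]; exact Ioo_subset_Icc_self hx) 0 (by simp)).deriv]
  rw [e1, e2, key]
  ring

/-! ### Beta integrals and the balanced weight -/

lemma integrable_and_integral_beta {u v : ℝ} (hu : 0 < u) (hv : 0 < v) :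
    Integrable (fun x : ℝ => x ^ (u - 1) * (1 - x) ^ (v - 1)) unitVol ∧
      ∫ x, x ^ (u - 1) * (1 - x) ^ (v - 1) ∂unitVol = ProbabilityTheory.beta u v := by
  have hc := Complex.betaIntegral_convergent (u := u) (v := v) (by simpa) (by simpa)
  rw [intervalIntegrable_iff_integrableOn_Ioo_of_le zero_le_one] at hc
  have he : ∀ x ∈ Ioo (0 : ℝ) 1, (x : ℂ) ^ ((u : ℂ) - 1) * (1 - (x : ℂ)) ^ ((v : ℂ) - 1) =
      ((x ^ (u - 1) * (1 - x) ^ (v - 1) : ℝ) : ℂ) := fun x hx => by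
    rw [Complex.ofReal_mul, Complex.ofReal_cpow hx.1.le, Complex.ofReal_cpow (by linarith [hx.2])]
    push_cast
    rfl
  have hc' : Integrable (fun x : ℝ => ((x ^ (u - 1) * (1 - x) ^ (v - 1) : ℝ) : ℂ)) unitVol :=
    hc.congr_fun he measurableSet_Ioo
  refine ⟨by simpa using hc'.re, ?_⟩
  rw [ProbabilityTheory.beta_eq_betaIntegralReal u v hu hv, Complex.betaIntegral,
    intervalIntegral.integral_of_le zero_le_one, integral_Ioc_eq_integral_Ioo,
    setIntegral_congr_fun measurableSet_Ioo he, integral_complex_ofReal, Complex.ofReal_re]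

lemma integrable_rho {a b : ℝ} (ha : 0 < a) (hb : 0 < b) :
    Integrable (rho (a - 1) (b - 1)) unitVol := by
  refine (integrable_and_integral_beta hb ha).1.congr (.of_forall fun x => ?_)
  simp [rho, mul_comm]

lemma rho_pos (a b : ℝ) {x : ℝ} (hx : x ∈ Ioo (0 : ℝ) 1) : 0 < rho a b x :=
  mul_pos (Real.rpow_pos_of_pos (by linarith [hx.2]) _) (Real.rpow_pos_of_pos hx.1 _)

/-- The left fractional integral of the weight `rho (a - 1) (b - 1)`, up to a constant. -/
def abelRho (α a b x : ℝ) : ℝ :=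
  ∫ t in (0 : ℝ)..x, (x - t) ^ (1 - α) * rho (a - 1) (b - 1) t

lemma continuousOn_one_sub_mul_rpow {x : ℝ} (hx : x ∈ Ioo (0 : ℝ) 1) (c : ℝ) :
    ContinuousOn (fun s : ℝ => (1 - x * s) ^ c) (Icc 0 1) := by
  refine ContinuousOn.rpow_const (by fun_prop) fun s hs => Or.inl ?_
  nlinarith [hx.1, hx.2, hs.1, hs.2]

lemma integrable_beta_mul {u v x : ℝ} (hu : 0 < u) (hv : 0 < v) (hx : x ∈ Ioo (0 : ℝ) 1) (c : ℝ) :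
    Integrable (fun s : ℝ => s ^ (u - 1) * (1 - s) ^ (v - 1) * (1 - x * s) ^ c) unitVol :=
  intervalIntegrable_iff_unitVol.1 ((intervalIntegrable_iff_unitVol.2
    (integrable_and_integral_beta hu hv).1).mul_continuousOn (by
      rw [uIcc_of_le zero_le_one]; exact continuousOn_one_sub_mul_rpow hx c))

/-- The scaling t = x s; a + b = α makes the powers of x combine to 1 - a. -/
lemma abelRho_eq {α a b x : ℝ} (hab : a + b = α) (hx : x ∈ Ioo (0 : ℝ) 1) :
    abelRho α a b x = x ^ (1 - a) *
      ∫ s, s ^ (b - 1) * (1 - s) ^ ((2 - α) - 1) * (1 - x * s) ^ (a - 1) ∂unitVol := by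
  have h := intervalIntegral.integral_comp_mul_left (a := 0) (b := 1)
    (fun t => (x - t) ^ (1 - α) * rho (a - 1) (b - 1) t) hx.1.ne'
  rw [mul_zero, mul_one, smul_eq_mul, eq_inv_mul_iff_mul_eq₀ hx.1.ne'] at h
  rw [abelRho, ← h, intervalIntegral_eq_unitVol, ← integral_const_mul, ← integral_const_mul]
  refine setIntegral_congr_fun measurableSet_Ioo fun s hs => ?_
  have e : x ^ (1 - a) = x * (x ^ (1 - α) * x ^ (b - 1)) := by
    rw [show 1 - a = 1 + ((1 - α) + (b - 1)) by linarith, Real.rpow_add hx.1, Real.rpow_add hx.1,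
      Real.rpow_one]
  simp only [rho]
  rw [show x - x * s = x * (1 - s) by ring, Real.mul_rpow hx.1.le (by linarith [hs.2]),
    Real.mul_rpow hx.1.le hs.1.le, e, show 2 - α - 1 = 1 - α by ring]
  ring

/-- The Möbius substitution `s ↦ s (1 - x) / (1 - x s)` of the unit interval. -/
lemma integral_beta_mul {b c x : ℝ} (hb : 0 < b) (hc : 0 < c) (hx : x ∈ Ioo (0 : ℝ) 1) :
    ∫ s, s ^ (b - 1) * (1 - s) ^ (c - 1) * (1 - x * s) ^ (-b - c) ∂unitVol =
      (1 - x) ^ (-b) * ProbabilityTheory.beta b c := by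
  have hx1 : 0 < 1 - x := by linarith [hx.2]
  have hpos : ∀ s ∈ Ioo (0 : ℝ) 1, 0 < 1 - x * s := fun s hs => by
    nlinarith [hx.1, hx.2, hs.1, hs.2]
  set σ : ℝ → ℝ := fun s => s * (1 - x) / (1 - x * s)
  have hσ1 : ∀ s ∈ Ioo (0 : ℝ) 1, 1 - σ s = (1 - s) / (1 - x * s) := fun s hs => by
    have := (hpos s hs).ne'
    simp only [σ]
    rw [one_sub_div this]
    congr 1
    ring
  have hmaps : ∀ s ∈ Ioo (0 : ℝ) 1, σ s ∈ Ioo (0 : ℝ) 1 := fun s hs => by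
    refine ⟨div_pos (mul_pos hs.1 hx1) (hpos s hs), ?_⟩
    have : 0 < 1 - σ s := by
      rw [hσ1 s hs]; exact div_pos (by linarith [hs.2]) (hpos s hs)
    linarith
  have himg : σ '' Ioo 0 1 = Ioo 0 1 := by
    refine Subset.antisymm (image_subset_iff.2 hmaps) fun y hy => ?_
    have hd : 0 < 1 - x + x * y := by nlinarith [hx.1, hy.1]
    have hd' : 1 - x * (y / (1 - x + x * y)) = (1 - x) / (1 - x + x * y) := by
      rw [← mul_div_assoc, one_sub_div hd.ne']
      congr 1
      ring
    refine ⟨y / (1 - x + x * y), ⟨div_pos hy.1 hd, (div_lt_one hd).2 ?_⟩, ?_⟩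
    · nlinarith [hy.2]
    · simp only [σ]
      rw [hd', div_mul_eq_mul_div, div_div_div_cancel_right₀ hd.ne', mul_div_cancel_right₀ _ hx1.ne']
  have hinj : InjOn σ (Ioo 0 1) := fun s hs t ht hst => by
    have h1 := (hpos s hs).ne'
    have h2 := (hpos t ht).ne'
    simp only [σ] at hst
    rw [div_eq_div_iff h1 h2] at hst
    have : (1 - x) * (s - t) = 0 := by linear_combination hst
    rcases mul_eq_zero.1 this with h | h <;> linarith
  have hder : ∀ s ∈ Ioo (0 : ℝ) 1,
      HasDerivWithinAt σ ((1 - x) / (1 - x * s) ^ 2) (Ioo 0 1) s := fun s hs => by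
    have h1 := (hpos s hs).ne'
    have := ((hasDerivAt_id s).mul_const (1 - x)).fun_div
      (((hasDerivAt_id s).const_mul x).const_sub 1) h1
    refine (this.congr_deriv ?_).hasDerivWithinAt
    simp only [id]
    field_simp
    ring
  -- The factor 1 - x s collects the exponent -(b-1) - (c-1) - 2 = -b - c, so this power is the one
  -- for which the integral is elementary.
  have key := integral_image_eq_integral_abs_deriv_smul measurableSet_Ioo hder hinj
    (fun y : ℝ => y ^ (b - 1) * (1 - y) ^ (c - 1))
  rw [himg, (integrable_and_integral_beta hb hc).2] at key
  rw [key, ← integral_const_mul]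
  refine setIntegral_congr_fun measurableSet_Ioo fun s hs => ?_
  have h1 := hpos s hs
  have h2 : 0 ≤ s * (1 - x) := mul_nonneg hs.1.le hx1.le
  simp only [smul_eq_mul]
  rw [hσ1 s hs, abs_of_pos (by positivity), Real.div_rpow (sub_nonneg.2 hs.2.le) h1.le]
  simp only [σ]
  rw [Real.div_rpow h2 h1.le, Real.mul_rpow hs.1.le hx1.le,
    Real.rpow_sub_one hx1.ne', Real.rpow_sub_one h1.ne', Real.rpow_sub_one h1.ne',
    Real.rpow_neg hx1.le, Real.rpow_sub h1, Real.rpow_neg h1.le]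
  have := Real.rpow_pos_of_pos hx1 b
  have := Real.rpow_pos_of_pos h1 b
  have := Real.rpow_pos_of_pos h1 c
  generalize 1 - x * s = q at *
  field_simp

/-- Differentiating the product in `abelRho_eq`, the two terms combine through (1 - x s) + x s = 1
into one integral with the power a - 2 = -b - (2 - α), which `integral_beta_mul` evaluates in closed
form. -/
lemma hasDerivAt_abelRho {α a b x : ℝ} (hα₂ : α < 2) (hab : a + b = α) (ha : 0 < a) (hb : 0 < b)
    (ha1 : a ≤ 1) (hx : x ∈ Ioo (0 : ℝ) 1) :
    HasDerivAt (abelRho α a b)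
      (ProbabilityTheory.beta b (2 - α) * (1 - a) * (x ^ (-a) * (1 - x) ^ (-b))) x := by
  have hc : 0 < 2 - α := by linarith
  set w : ℝ → ℝ := fun s => s ^ (b - 1) * (1 - s) ^ ((2 - α) - 1)
  have hw : ∀ s ∈ Ioo (0 : ℝ) 1, 0 ≤ w s := fun s hs =>
    mul_nonneg (Real.rpow_nonneg hs.1.le _) (Real.rpow_nonneg (by linarith [hs.2]) _)
  have hwi : Integrable w unitVol := (integrable_and_integral_beta hb hc).1
  -- A lower bound for 1 - y s valid for all y < (1 + x) / 2 and s in (0,1), needed for domination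
  -- because the power a - 2 is negative.
  set δ := (1 - x) / 2
  have hδ : 0 < δ := by simp only [δ]; linarith [hx.2]
  have hlow : ∀ y ∈ Ioo (0 : ℝ) ((1 + x) / 2), ∀ s ∈ Ioo (0 : ℝ) 1, δ ≤ 1 - y * s :=
    fun y hy s hs => by
      simp only [δ]; nlinarith [hy.1, hy.2, hs.1, hs.2]
  have hdiff := hasDerivAt_integral_of_dominated_loc_of_deriv_le (μ := unitVol) (𝕜 := ℝ)
    (F := fun y s => w s * (1 - y * s) ^ (a - 1))
    (F' := fun y s => w s * ((1 - a) * s * (1 - y * s) ^ (a - 2))) (x₀ := x)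
    (s := Ioo 0 ((1 + x) / 2)) (bound := fun s => w s * (1 * 1 * δ ^ (a - 2)))
    (Ioo_mem_nhds hx.1 (by linarith [hx.2])) ?_ (integrable_beta_mul hb hc hx _) ?_ ?_
    (hwi.mul_const _) ?_
  · obtain ⟨hi, hd⟩ := hdiff
    have hx2 : HasDerivAt (fun y : ℝ => y ^ (1 - a)) ((1 - a) * x ^ (1 - a - 1)) x :=
      Real.hasDerivAt_rpow_const (Or.inl hx.1.ne')
    refine ((hx2.fun_mul hd).congr_of_eventuallyEq ?_).congr_deriv ?_
    · filter_upwards [Ioo_mem_nhds hx.1 hx.2] with y hy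
      exact abelRho_eq hab hy
    · have hb' := integral_beta_mul hb hc hx
      rw [show -b - (2 - α) = a - 2 by linarith] at hb'
      have e1 : (1 - a) * ∫ s, w s * (1 - x * s) ^ (a - 1) ∂unitVol +
          x * ∫ s, w s * ((1 - a) * s * (1 - x * s) ^ (a - 2)) ∂unitVol =
          (1 - a) * ∫ s, w s * (1 - x * s) ^ (a - 2) ∂unitVol := by
        rw [← integral_const_mul, ← integral_const_mul, ← integral_const_mul,
          ← integral_add ((integrable_beta_mul hb hc hx _).const_mul _) (hi.const_mul _)]
        refine setIntegral_congr_fun measurableSet_Ioo fun s hs => ?_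
        have h1 : 0 < 1 - x * s := by nlinarith [hx.1, hx.2, hs.1, hs.2]
        rw [show a - 1 = 1 + (a - 2) by ring, Real.rpow_add h1, Real.rpow_one]
        ring
      rw [hb'] at e1
      rw [show 1 - a - 1 = -a by ring, show 1 - a = 1 + -a by ring, Real.rpow_add hx.1,
        Real.rpow_one, ← sub_eq_add_neg]
      linear_combination x ^ (-a) * e1
  · filter_upwards [Ioo_mem_nhds hx.1 hx.2] with y hy
    exact (integrable_beta_mul hb hc hy _).aestronglyMeasurable
  · refine (Measurable.aestronglyMeasurable ?_)
    simp only [w]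
    fun_prop
  · filter_upwards [ae_restrict_mem measurableSet_Ioo] with s hs y hy
    have h1 := hlow y hy s hs
    rw [norm_mul (w s), norm_mul ((1 - a) * s), norm_mul (1 - a), Real.norm_of_nonneg (hw s hs),
      Real.norm_of_nonneg (sub_nonneg.2 ha1), Real.norm_of_nonneg hs.1.le,
      Real.norm_of_nonneg (Real.rpow_nonneg (hδ.le.trans h1) _)]
    refine mul_le_mul_of_nonneg_left (mul_le_mul (mul_le_mul (by linarith) hs.2.le hs.1.le
      zero_le_one) (Real.rpow_le_rpow_of_nonpos hδ h1 (by linarith))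
      (Real.rpow_nonneg (hδ.le.trans h1) _) (by norm_num)) (hw s hs)
  · filter_upwards [ae_restrict_mem measurableSet_Ioo] with s hs y hy
    have h1 := hδ.trans_le (hlow y hy s hs)
    have := (((((hasDerivAt_id y).mul_const s).const_sub 1).rpow_const (p := a - 1)
      (Or.inl h1.ne')).const_mul (w s))
    refine this.congr_deriv ?_
    rw [show a - 1 - 1 = a - 2 by ring]
    simp only [id]
    ring

lemma abelRho_pos {α a b x : ℝ} (hα₂ : α < 2) (hab : a + b = α) (hb : 0 < b)
    (hx : x ∈ Ioo (0 : ℝ) 1) : 0 < abelRho α a b x := by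
  rw [abelRho_eq hab hx, ← intervalIntegral_eq_unitVol]
  refine mul_pos (Real.rpow_pos_of_pos hx.1 _) (intervalIntegral.intervalIntegral_pos_of_pos_on
    (intervalIntegrable_iff_unitVol.2 (integrable_beta_mul hb (by linarith) hx _))
    (fun s hs => ?_) zero_lt_one)
  have h1 : 0 < 1 - x * s := by nlinarith [hx.1, hx.2, hs.1, hs.2]
  exact mul_pos (mul_pos (Real.rpow_pos_of_pos hs.1 _) (Real.rpow_pos_of_pos (by linarith [hs.2]) _))
    (Real.rpow_pos_of_pos h1 _)

/-- The balance between the two exponents that makes the fractional integral of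
`rho (a - 1) (b - 1)` constant. -/
def Balanced (α r a b : ℝ) : Prop :=
  0 < a ∧ a ≤ 1 ∧ 0 < b ∧ b ≤ 1 ∧ a + b = α ∧
    r * (ProbabilityTheory.beta b (2 - α) * (1 - a)) =
      (1 - r) * (ProbabilityTheory.beta a (2 - α) * (1 - b))

lemma Balanced.swap {α r a b : ℝ} (h : Balanced α r a b) : Balanced α (1 - r) b a := by
  obtain ⟨h1, h2, h3, h4, h5, h6⟩ := h
  exact ⟨h3, h4, h1, h2, by rw [add_comm, h5], by rw [sub_sub_cancel, h6]⟩

/-- Condition A says r sin(π(α-β)) = (1-r) sin(πβ), and the reflection formula converts the sines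
into the Beta values. The denominator is positive since α < 2 prevents both sines from vanishing. -/
lemma ConditionA.balanced {α r β : ℝ} (hα₁ : 1 < α) (hα₂ : α < 2) (h : ConditionA α r β) :
    Balanced α r (α - β) β := by
  obtain ⟨h1, h2, h3⟩ := h
  refine ⟨by linarith, by linarith, by linarith, h2, by ring, ?_⟩
  have hs : ∀ c, α - 1 ≤ c → c ≤ 1 → 0 ≤ Real.sin (Real.pi * c) := fun c hc hc' =>
    Real.sin_nonneg_of_nonneg_of_le_pi (by have := Real.pi_pos; nlinarith)
      (by have := Real.pi_pos; nlinarith)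
  have hs' : ∀ c, α - 1 ≤ c → c < 1 → 0 < Real.sin (Real.pi * c) := fun c hc hc' =>
    Real.sin_pos_of_pos_of_lt_pi (by have := Real.pi_pos; nlinarith)
      (by have := Real.pi_pos; nlinarith)
  have hden : 0 < Real.sin (Real.pi * (α - β)) + Real.sin (Real.pi * β) := by
    rcases h2.lt_or_eq with h | h
    · have := hs' β h1 h
      have := hs (α - β) (by linarith) (by linarith)
      linarith
    · have := hs' (α - β) (by linarith) (by linarith)
      have := hs β h1 h2
      linarith
  have hsin : r * Real.sin (Real.pi * (α - β)) = (1 - r) * Real.sin (Real.pi * β) := by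
    rw [h3]; field_simp; ring
  -- The reflection formula, arranged so that it survives at c = 1, where Γ(1-c) has a pole but both
  -- sides here vanish. This covers the one-sided cases r = 0 and r = 1.
  have hbeta : ∀ c : ℝ, 0 < c → c ≤ 1 →
      (1 - c) / Real.Gamma (2 - c) = Real.Gamma c * Real.sin (Real.pi * c) / Real.pi := by
    intro c hc hc1
    rcases hc1.eq_or_lt with rfl | hc1
    · simp
    · have hG := Real.Gamma_mul_Gamma_one_sub c
      have h1 : 0 < Real.Gamma (1 - c) := Real.Gamma_pos_of_pos (by linarith)
      have h2 : 0 < Real.sin (Real.pi * c) := Real.sin_pos_of_pos_of_lt_pi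
        (by have := Real.pi_pos; positivity) (by have := Real.pi_pos; nlinarith)
      have h3 : 0 < 1 - c := by linarith
      rw [show 2 - c = (1 - c) + 1 by ring, Real.Gamma_add_one h3.ne']
      rw [eq_div_iff h2.ne'] at hG
      have := Real.Gamma_pos_of_pos hc
      generalize Real.sin (Real.pi * c) = S at *
      rw [← hG]
      field_simp
  have h4 := hbeta (α - β) (by linarith) (by linarith)
  have h5 := hbeta β (by linarith) h2
  rw [ProbabilityTheory.beta, ProbabilityTheory.beta, show β + (2 - α) = 2 - (α - β) by ring,
    show α - β + (2 - α) = 2 - β by ring]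
  calc _ = r * (Real.Gamma β * Real.Gamma (2 - α)) *
        ((1 - (α - β)) / Real.Gamma (2 - (α - β))) := by ring
    _ = (1 - r) * (Real.Gamma (α - β) * Real.Gamma (2 - α)) *
        ((1 - β) / Real.Gamma (2 - β)) := by
      rw [h4, h5]
      linear_combination (Real.Gamma β * Real.Gamma (2 - α) * Real.Gamma (α - β) / Real.pi) * hsin
    _ = _ := by ring

/-- The fractional integral of the balanced weight is a positive constant. -/
lemma kint_rho_eq_const {α r a b : ℝ} (hα₁ : 1 < α) (hα₂ : α < 2) (hr₀ : 0 ≤ r) (hr₁ : r ≤ 1)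
    (h : Balanced α r a b) :
    ∃ C, 0 < C ∧ ∀ᵐ x ∂unitVol, kint α r (rho (a - 1) (b - 1)) x = C := by
  obtain ⟨ha, ha1, hb, hb1, hab, hbal⟩ := h
  have hba : b + a = α := by rw [add_comm, hab]
  set F : ℝ → ℝ := fun x => r * abelRho α a b x + (1 - r) * abelRho α b a (1 - x)
  have hF : ∀ x ∈ Ioo (0 : ℝ) 1, HasDerivAt F 0 x := fun x hx => by
    have hx' : 1 - x ∈ Ioo (0 : ℝ) 1 := ⟨by linarith [hx.2], by linarith [hx.1]⟩
    have h1 := (hasDerivAt_abelRho hα₂ hab ha hb ha1 hx).const_mul r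
    have h2 := ((hasDerivAt_abelRho hα₂ hba hb ha hb1 hx').comp x
      ((hasDerivAt_id x).const_sub 1)).const_mul (1 - r)
    refine (h1.add h2).congr_deriv ?_
    rw [sub_sub_cancel]
    -- The left and right contributions have the same profile in x with opposite signs, so the
    -- balance cancels them.
    linear_combination (x ^ (-a) * (1 - x) ^ (-b)) * hbal
  have hhalf : (1 / 2 : ℝ) ∈ Ioo (0 : ℝ) 1 := by norm_num
  have hconst : ∀ x ∈ Ioo (0 : ℝ) 1, F x = F (1 / 2) := fun x hx =>
    isOpen_Ioo.is_const_of_deriv_eq_zero isPreconnected_Ioo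
      (fun y hy => (hF y hy).differentiableAt.differentiableWithinAt)
      (fun y hy => (hF y hy).deriv) hx hhalf
  have hG : 0 < Real.Gamma (2 - α) := Real.Gamma_pos_of_pos (by linarith)
  refine ⟨1 / Real.Gamma (2 - α) * F (1 / 2), mul_pos (by positivity) ?_, ?_⟩
  · have h1 := abelRho_pos hα₂ hab hb hhalf
    have h2 := abelRho_pos hα₂ hba ha hhalf
    simp only [F, show (1 : ℝ) - 1 / 2 = 1 / 2 by norm_num]
    rcases hr₀.eq_or_lt with rfl | hr
    · simpa using h2
    · have := mul_pos hr h1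
      have := mul_nonneg (sub_nonneg.2 hr₁) h2.le
      linarith
  · filter_upwards [mixedInt_ae_eq_kint hα₁ hα₂ r (integrable_rho ha hb),
      ae_restrict_mem measurableSet_Ioo] with x h1 hx
    have h0 : ∀ y : ℝ, 0 ≤ y → 1 / y ^ (α - 1) = y ^ (1 - α) := fun y hy => by
      rw [one_div, ← Real.rpow_neg hy, neg_sub]
    rw [← h1, ← hconst x hx]
    have hl : leftInt α (rho (a - 1) (b - 1)) x = 1 / Real.Gamma (2 - α) * abelRho α a b x := by
      rw [leftInt, abelRho]
      congr 1
      refine intervalIntegral.integral_congr fun t ht => ?_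
      rw [uIcc_of_le hx.1.le] at ht
      simp only [h0 _ (sub_nonneg.2 ht.2)]
    have hr : rightInt α (rho (a - 1) (b - 1)) x =
        1 / Real.Gamma (2 - α) * abelRho α b a (1 - x) := by
      rw [rightInt, abelRho]
      congr 1
      have := intervalIntegral.integral_comp_sub_left (a := 0) (b := 1 - x)
        (fun t => 1 / (t - x) ^ (α - 1) * rho (a - 1) (b - 1) t) 1
      rw [sub_sub_cancel, sub_zero] at this
      rw [← this]
      refine intervalIntegral.integral_congr fun t ht => ?_
      rw [uIcc_of_le (by linarith [hx.2])] at ht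
      simp only [rho]
      rw [h0 _ (by linarith [ht.2]), show 1 - t - x = 1 - x - t by ring, sub_sub_cancel,
        mul_comm (t ^ (a - 1))]
    simp only [mixedInt, hl, hr, F]
    ring

/-! ### The operator on polynomials times the balanced weight -/

open Polynomial in
lemma exists_derivative_eq (p : ℝ[X]) : ∃ q : ℝ[X], derivative q = p ∧ q.eval 0 = 0 := by
  induction p using Polynomial.induction_on' with
  | add p₁ p₂ h₁ h₂ =>
    obtain ⟨q₁, h₁, h₁'⟩ := h₁
    obtain ⟨q₂, h₂, h₂'⟩ := h₂
    exact ⟨q₁ + q₂, by simp [h₁, h₂], by simp [h₁', h₂']⟩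
  | monomial n c =>
    refine ⟨monomial (n + 1) (c / (n + 1)), ?_, by simp⟩
    have : (n : ℝ) + 1 ≠ 0 := by positivity
    rw [derivative_monomial]
    simp [div_mul_cancel₀ _ this]

open Polynomial in
lemma integral_eval_derivative (q : ℝ[X]) (x y : ℝ) :
    ∫ t in x..y, (derivative q).eval t = q.eval y - q.eval x :=
  intervalIntegral.integral_eq_sub_of_hasDerivAt (fun t _ => q.hasDerivAt t)
    ((derivative q).continuous.intervalIntegrable _ _)

lemma _root_.MeasureTheory.Integrable.mul_continuous_unitVol {g q : ℝ → ℝ} (hg : Integrable g unitVol)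
    (hq : ContinuousOn q (Icc 0 1)) : Integrable (fun t => g t * q t) unitVol :=
  intervalIntegrable_iff_unitVol.1 ((intervalIntegrable_iff_unitVol.2 hg).mul_continuousOn
    (by rwa [uIcc_of_le zero_le_one]))

/-- The ratio of the leading coefficients of the image of `t ^ n` and of the image of `1`. -/
def leadCoef (α : ℝ) (n : ℕ) : ℝ := ∏ i ∈ Finset.range n, ((i : ℝ) + α - 1) / (i + 1)

lemma leadCoef_pos {α : ℝ} (hα₁ : 1 < α) (n : ℕ) : 0 < leadCoef α n :=
  Finset.prod_pos fun i _ => div_pos (by have : (0 : ℝ) ≤ i := by positivity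
                                         linarith) (by positivity)

lemma succ_mul_leadCoef_succ (α : ℝ) (n : ℕ) :
    ((n : ℝ) + 1) * leadCoef α (n + 1) = ((n : ℝ) + α - 1) * leadCoef α n := by
  rw [leadCoef, Finset.prod_range_succ, ← leadCoef]
  field_simp

/-- The sequence starts at α - 1 and is nondecreasing because α > 1. It supplies the uniform lower
bound on the diagonal entries in the existence proof. -/
lemma le_succ_mul_leadCoef_succ {α : ℝ} (hα₁ : 1 < α) (n : ℕ) :
    α - 1 ≤ ((n : ℝ) + 1) * leadCoef α (n + 1) := by
  induction n with
  | zero => simp [leadCoef]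
  | succ n ih =>
    rw [succ_mul_leadCoef_succ]
    refine ih.trans ?_
    have := leadCoef_pos hα₁ (n + 1)
    push_cast
    nlinarith

open Polynomial in
/-- The kernel operator maps the balanced weight times a monomial to a polynomial. -/
lemma exists_kint_rho_mul_pow {α r a b C : ℝ} (hα₁ : 1 < α) (hα₂ : α < 2)
    (ha : 0 < a) (hb : 0 < b)
    (hC : ∀ᵐ x ∂unitVol, kint α r (rho (a - 1) (b - 1)) x = C) (n : ℕ) :
    ∃ j : ℝ[X], (∀ᵐ x ∂unitVol, kint α r (fun t => rho (a - 1) (b - 1) t * t ^ n) x = j.eval x) ∧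
      j.coeff n = C * leadCoef α n ∧ ∀ k, n < k → j.coeff k = 0 := by
  induction n with
  | zero =>
    refine ⟨Polynomial.C C, ?_, by simp [leadCoef], fun k hk => coeff_C_of_ne_zero hk.ne'⟩
    simpa using hC
  | succ n ih =>
    obtain ⟨j, hj, hjn, hjk⟩ := ih
    obtain ⟨q, hq, hq0⟩ := exists_derivative_eq j
    set w : ℝ → ℝ := fun t => rho (a - 1) (b - 1) t * t ^ n
    have hw : Integrable w unitVol :=
      (integrable_rho ha hb).mul_continuous_unitVol (continuous_pow n).continuousOn
    set c := ∫ t, kernPrim α r (0 - t) * w t ∂unitVol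
    -- By `mul_kern` the image of t^(n+1) is x j minus (2 - α) times an integral against `kernPrim`,
    -- which is `c` plus the primitive `q` of j. The diagonal entry is thus multiplied by 1 - (2 -
    -- α)/(n + 1).
    have hcoef : ∀ k, (X * j - (2 - α) • (Polynomial.C c + q)).coeff (k + 1) =
        j.coeff k * (((k : ℝ) + α - 1) / (k + 1)) := fun k => by
      have : j.coeff k = q.coeff (k + 1) * (k + 1) := by rw [← hq, coeff_derivative]
      rw [coeff_sub, coeff_X_mul, coeff_smul, coeff_add, coeff_C_succ, zero_add, smul_eq_mul, this]
      field_simp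
      ring
    refine ⟨X * j - (2 - α) • (Polynomial.C c + q), ?_, ?_, ?_⟩
    · filter_upwards [hj, ae_integrable_kern_mul hα₁ hα₂ r hw,
        ae_restrict_mem measurableSet_Ioo] with x h1 h2 hx
      have h3 : ∫ y in (0 : ℝ)..x, kint α r w y = q.eval x := by
        have : ∫ y in (0 : ℝ)..x, kint α r w y = ∫ y in (0 : ℝ)..x, j.eval y := by
          refine intervalIntegral.integral_congr_ae ?_
          rw [← ae_restrict_iff' measurableSet_uIoc]
          rw [uIoc_of_le hx.1.le, ← Measure.restrict_congr_set Ioo_ae_eq_Ioc]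
          exact ae_mono (Measure.restrict_mono (Ioo_subset_Ioo_right hx.2.le) le_rfl) hj
        rw [this, ← hq, integral_eval_derivative, hq0, sub_zero]
      rw [integral_kint hα₁ hα₂ r hw (Ioo_subset_Icc_self hx)] at h3
      have h4 : kint α r (fun t => rho (a - 1) (b - 1) t * t ^ (n + 1)) x =
          x * kint α r w x - (2 - α) * ∫ t, kernPrim α r (x - t) * w t ∂unitVol := by
        rw [kint, kint, ← integral_const_mul, ← integral_const_mul, ← integral_sub
          (h2.const_mul x) ((integrable_kernPrim_mul hα₂ r x hw).const_mul _)]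
        refine integral_congr_ae (.of_forall fun t => ?_)
        simp only [w]
        linear_combination -(rho (a - 1) (b - 1) t * t ^ n) * mul_kern hα₁ hα₂ r (x - t)
      rw [h4, h1]
      simp only [eval_sub, eval_mul, eval_X, eval_smul, eval_add, eval_C, smul_eq_mul]
      linear_combination -(2 - α) * h3
    · rw [hcoef, hjn, leadCoef, leadCoef, Finset.prod_range_succ, mul_assoc]
    · intro k hk
      obtain ⟨k, rfl⟩ := Nat.exists_eq_add_one_of_ne_zero (show k ≠ 0 by omega)
      rw [hcoef, hjk k (by omega), zero_mul]

open Polynomial in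
/-- The action of the kernel operator on polynomials times the balanced weight. -/
lemma exists_linearMap_kint {α r a b C : ℝ} (hα₁ : 1 < α) (hα₂ : α < 2)
    (ha : 0 < a) (hb : 0 < b)
    (hC : ∀ᵐ x ∂unitVol, kint α r (rho (a - 1) (b - 1)) x = C) :
    ∃ J : ℝ[X] →ₗ[ℝ] ℝ[X],
      (∀ p, ∀ᵐ x ∂unitVol, kint α r (fun t => rho (a - 1) (b - 1) t * p.eval t) x = (J p).eval x) ∧
      ∀ n p, (∀ k, n < k → p.coeff k = 0) →
        (J p).coeff n = C * leadCoef α n * p.coeff n ∧ ∀ k, n < k → (J p).coeff k = 0 := by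
  choose j hj hjn hjk using exists_kint_rho_mul_pow hα₁ hα₂ ha hb hC
  set J : ℝ[X] →ₗ[ℝ] ℝ[X] := (Polynomial.basisMonomials ℝ).constr ℝ j
  have hJ : ∀ n c, J (monomial n c) = c • j n := fun n c => by
    have : monomial n c = c • (Polynomial.basisMonomials ℝ n) := by simp [smul_monomial]
    rw [this, map_smul, Module.Basis.constr_basis]
  have hint : ∀ p : ℝ[X], Integrable (fun t => rho (a - 1) (b - 1) t * p.eval t) unitVol :=
    fun p => (integrable_rho ha hb).mul_continuous_unitVol p.continuous.continuousOn
  refine ⟨J, fun p => ?_, fun n p hp => ?_⟩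
  · induction p using Polynomial.induction_on' with
    | add p₁ p₂ h₁ h₂ =>
      filter_upwards [h₁, h₂, kint_add_ae hα₁ hα₂ r (hint p₁) (hint p₂)] with x e₁ e₂ e
      simp only [eval_add, mul_add, map_add, ← e₁, ← e₂, e]
    | monomial n c =>
      filter_upwards [hj n] with x e
      have := kint_const_mul α r c (fun t => rho (a - 1) (b - 1) t * t ^ n) x
      simp only [hJ, eval_monomial, eval_smul, smul_eq_mul, ← e, ← this]
      congr 1
      ext t
      ring
  · have hdeg : p.natDegree < n + 1 := by
      rw [Nat.lt_succ_iff, natDegree_le_iff_coeff_eq_zero]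
      exact hp
    have hsum : ∀ k, (J p).coeff k = ∑ i ∈ Finset.range (n + 1), p.coeff i * (j i).coeff k :=
      fun k => by
        conv_lhs => rw [p.as_sum_range' (n + 1) hdeg]
        simp [hJ]
    constructor
    · rw [hsum, Finset.sum_range_succ, hjn, Finset.sum_eq_zero, zero_add, mul_comm]
      intro i hi
      rw [hjk i n (Finset.mem_range.1 hi), mul_zero]
    · intro k hk
      rw [hsum]
      refine Finset.sum_eq_zero fun i hi => ?_
      rw [hjk i k (by have := Finset.mem_range.1 hi; omega), mul_zero]

open Polynomial in
-- Nonzero diagonal entries allow the top coefficient to be cleared, one degree at a time.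
lemma exists_map_eq_of_triangular (J : ℝ[X] →ₗ[ℝ] ℝ[X]) (μ : ℕ → ℝ) (hμ : ∀ n, μ n ≠ 0)
    (hJ : ∀ n p, (∀ k, n < k → p.coeff k = 0) →
      (J p).coeff n = μ n * p.coeff n ∧ ∀ k, n < k → (J p).coeff k = 0)
    (n : ℕ) (p : ℝ[X]) (hp : ∀ k, n ≤ k → p.coeff k = 0) :
    ∃ d : ℝ[X], (∀ k, n ≤ k → d.coeff k = 0) ∧ J d = p := by
  induction n generalizing p with
  | zero => exact ⟨0, by simp, by rw [map_zero]; ext k; simpa using (hp k (Nat.zero_le k)).symm⟩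
  | succ n ih =>
    set m := monomial n (p.coeff n / μ n)
    have hm : ∀ k, n < k → m.coeff k = 0 := fun k hk => coeff_monomial_of_ne _ hk.ne'
    obtain ⟨h1, h2⟩ := hJ n m hm
    obtain ⟨d, hd, hd'⟩ := ih (p - J m) (fun k hk => by
      rcases hk.eq_or_lt with rfl | hk
      · rw [coeff_sub, h1, coeff_monomial_same, mul_div_cancel₀ _ (hμ n), sub_self]
      · rw [coeff_sub, h2 k hk, hp k hk, sub_zero])
    exact ⟨d + m, fun k hk => by rw [coeff_add, hd k (by omega), hm k hk, zero_add],
      by rw [map_add, hd', sub_add_cancel]⟩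

/-! ### Duality and injectivity of the operator -/

/-- Fubini for the pairing with a balanced weight, which may be unbounded. -/
lemma integrable_kern_mul_rho {α r a b : ℝ} (hα₁ : 1 < α) (hα₂ : α < 2) (hr₀ : 0 ≤ r)
    (hr₁ : r ≤ 1) (h : Balanced α r a b) {g q : ℝ → ℝ} (hg : Integrable g unitVol)
    (hq : Continuous q) :
    Integrable (fun p : ℝ × ℝ => kern α r (p.1 - p.2) * g p.2 *
      (rho (b - 1) (a - 1) p.1 * q p.1)) (unitVol.prod unitVol) := by
  -- Tonelli replaces boundedness of the weight: integrating the nonnegative kernel against it in x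
  -- gives the constant `C`, so the double integral of absolute values is `C` times the L¹ norm of
  -- g.
  obtain ⟨C, -, hC⟩ := kint_rho_eq_const hα₁ hα₂ (sub_nonneg.2 hr₁) (by linarith) h.swap
  have hφ : Integrable (rho (b - 1) (a - 1)) unitVol := integrable_rho h.2.2.1 h.1
  have hk := integrable_kern_mul_prod hα₁ hα₂ r hg
  have hm : AEStronglyMeasurable (fun p : ℝ × ℝ => kern α r (p.1 - p.2) * g p.2 *
      rho (b - 1) (a - 1) p.1) (unitVol.prod unitVol) :=
    hk.aestronglyMeasurable.mul hφ.aestronglyMeasurable.comp_fst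
  have hmain : Integrable (fun p : ℝ × ℝ => kern α r (p.1 - p.2) * g p.2 *
      rho (b - 1) (a - 1) p.1) (unitVol.prod unitVol) := by
    rw [integrable_prod_iff' hm]
    refine ⟨?_, ?_⟩
    · filter_upwards [ae_integrable_kern_mul hα₁ hα₂ (1 - r) hφ] with t ht
      refine (ht.const_mul (g t)).congr (.of_forall fun x => ?_)
      simp only [kern_one_sub hα₁, neg_sub]
      ring
    · refine (hg.norm.mul_const C).congr ?_
      filter_upwards [hC] with t ht
      rw [← ht, kint, ← integral_const_mul]
      refine setIntegral_congr_fun measurableSet_Ioo fun x hx => ?_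
      simp only [norm_mul, Real.norm_of_nonneg (kern_nonneg hα₂ hr₀ hr₁ _),
        Real.norm_of_nonneg (rho_pos (b - 1) (a - 1) hx).le, kern_one_sub hα₁, neg_sub]
      ring
  obtain ⟨M, hM⟩ := isCompact_Icc.exists_bound_of_continuousOn (hq.continuousOn (s := Icc 0 1))
  refine (hmain.mul_bdd (c := M) (g := fun p : ℝ × ℝ => q p.1)
    (hq.comp continuous_fst).aestronglyMeasurable ?_).congr (.of_forall fun p => by ring)
  rw [Measure.prod_restrict]
  filter_upwards [ae_restrict_mem (measurableSet_Ioo.prod measurableSet_Ioo)] with p hp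
  exact hM _ (Ioo_subset_Icc_self hp.1)

lemma integral_kint_mul_rho {α r a b : ℝ} (hα₁ : 1 < α) (hα₂ : α < 2) (hr₀ : 0 ≤ r)
    (hr₁ : r ≤ 1) (h : Balanced α r a b) {g q : ℝ → ℝ} (hg : Integrable g unitVol)
    (hq : Continuous q) :
    ∫ x, kint α r g x * (rho (b - 1) (a - 1) x * q x) ∂unitVol =
      ∫ t, g t * kint α (1 - r) (fun x => rho (b - 1) (a - 1) x * q x) t ∂unitVol :=
  integral_kint_mul hα₁ r (φ := fun x => rho (b - 1) (a - 1) x * q x)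
    (integrable_kern_mul_rho hα₁ hα₂ hr₀ hr₁ h hg hq)

lemma integrable_kint_mul_rho {α r a b : ℝ} (hα₁ : 1 < α) (hα₂ : α < 2) (hr₀ : 0 ≤ r)
    (hr₁ : r ≤ 1) (h : Balanced α r a b) {g q : ℝ → ℝ} (hg : Integrable g unitVol)
    (hq : Continuous q) :
    Integrable (fun x => kint α r g x * (rho (b - 1) (a - 1) x * q x)) unitVol := by
  refine (integrable_kern_mul_rho hα₁ hα₂ hr₀ hr₁ h hg hq).integral_prod_left.congr
    (.of_forall fun x => ?_)
  simp only [kint, integral_mul_const]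

lemma ae_eq_zero_of_integral_mul_test {w : ℝ → ℝ} (hw : Integrable w unitVol)
    (h : ∀ η, IsTest η → ∫ x, w x * η x ∂unitVol = 0) : w =ᵐ[unitVol] 0 := by
  have := isOpen_Ioo.ae_eq_zero_of_integral_contDiff_smul_eq_zero (U := Ioo (0 : ℝ) 1) (f := w)
    (μ := volume) (IntegrableOn.locallyIntegrableOn hw) fun η hη _ hηU => by
      rw [← h η ⟨hη, hηU⟩, ← setIntegral_eq_integral_of_forall_compl_eq_zero
        (s := Ioo (0 : ℝ) 1)]
      · simp [mul_comm]
      · intro x hx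
        rw [image_eq_zero_of_notMem_tsupport fun hx' => hx (hηU hx'), zero_smul]
  rw [EventuallyEq, ae_restrict_iff' measurableSet_Ioo]
  simpa using this

open Polynomial in
/-- An integrable function all of whose moments vanish is zero. -/
lemma ae_eq_zero_of_integral_mul_eval {w : ℝ → ℝ} (hw : Integrable w unitVol)
    (h : ∀ p : ℝ[X], ∫ x, w x * p.eval x ∂unitVol = 0) : w =ᵐ[unitVol] 0 := by
  have key : ∀ η : ℝ → ℝ, Continuous η → ∫ x, w x * η x ∂unitVol = 0 := by
    intro η hη
    set M := ∫ x, ‖w x‖ ∂unitVol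
    have hM : 0 ≤ M := integral_nonneg fun _ => norm_nonneg _
    refine norm_le_zero_iff.1 (le_of_forall_pos_le_add fun ε hε => ?_)
    obtain ⟨p, hp⟩ := exists_polynomial_near_of_continuousOn 0 1 η hη.continuousOn (ε / (M + 1))
      (by positivity)
    have e : ∫ x, w x * η x ∂unitVol = ∫ x, w x * (η x - p.eval x) ∂unitVol := by
      simp only [mul_sub]
      rw [integral_sub (hw.mul_continuous_unitVol hη.continuousOn)
        (hw.mul_continuous_unitVol p.continuous.continuousOn), h p, sub_zero]
    rw [e, zero_add]
    calc _ ≤ ∫ x, ‖w x‖ * (ε / (M + 1)) ∂unitVol := by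
          refine norm_integral_le_of_norm_le (hw.norm.mul_const _) ?_
          filter_upwards [ae_restrict_mem measurableSet_Ioo] with x hx
          rw [norm_mul, Real.norm_eq_abs (_ - _), abs_sub_comm]
          exact mul_le_mul_of_nonneg_left (hp x (Ioo_subset_Icc_self hx)).le (norm_nonneg _)
      _ = M * (ε / (M + 1)) := integral_mul_const _ _
      _ ≤ ε := by rw [mul_div_assoc', div_le_iff₀ (by positivity)]; nlinarith
  exact ae_eq_zero_of_integral_mul_test hw fun η hη => key η hη.continuous

open Polynomial in
/-- The kernel operator is injective on integrable functions. -/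
lemma ae_eq_zero_of_kint_ae_eq_zero {α r a b : ℝ} (hα₁ : 1 < α) (hα₂ : α < 2) (hr₀ : 0 ≤ r)
    (hr₁ : r ≤ 1) (h : Balanced α r a b) {g : ℝ → ℝ} (hg : Integrable g unitVol)
    (hk : kint α r g =ᵐ[unitVol] 0) : g =ᵐ[unitVol] 0 := by
  obtain ⟨C, hC0, hC⟩ := kint_rho_eq_const hα₁ hα₂ (sub_nonneg.2 hr₁) (by linarith) h.swap
  obtain ⟨J, hJ, hJn⟩ := exists_linearMap_kint hα₁ hα₂ h.2.2.1 h.1 hC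
  -- Here `J` represents the transpose on the mirrored weight, so K g = 0 makes g orthogonal to its
  -- range. That range contains every polynomial.
  have hrange : ∀ q : ℝ[X], ∫ x, g x * (J q).eval x ∂unitVol = 0 := fun q => by
    have := integral_kint_mul_rho hα₁ hα₂ hr₀ hr₁ h hg q.continuous
    rw [integral_eq_zero_of_ae (by filter_upwards [hk] with x hx; simp [hx])] at this
    rw [this]
    refine integral_congr_ae ?_
    filter_upwards [hJ q] with x hx
    rw [hx]
  refine ae_eq_zero_of_integral_mul_eval hg fun p => ?_
  obtain ⟨d, -, rfl⟩ := exists_map_eq_of_triangular J _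
    (fun n => (mul_pos hC0 (leadCoef_pos hα₁ n)).ne') hJn (p.natDegree + 1) p
    fun k hk => Polynomial.coeff_eq_zero_of_natDegree_lt hk
  exact hrange d

/-! ### Abstract lower bound and solvability of the dual problem -/

section HilbertSpace

open Polynomial

variable {H₁ H₂ : Type*} [NormedAddCommGroup H₁] [InnerProductSpace ℝ H₁]
  [NormedAddCommGroup H₂] [InnerProductSpace ℝ H₂]

/-- A lower bound for an operator on polynomials whose Gram operator is triangular. -/
lemma mul_norm_sq_le_of_triangular (P₁ : ℝ[X] →ₗ[ℝ] H₁) (P₂ : ℝ[X] →ₗ[ℝ] H₂)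
    (A B : ℝ[X] →ₗ[ℝ] ℝ[X]) (κ : ℕ → ℝ) (c : ℝ)
    (hadj : ∀ p q, inner ℝ (P₂ (A p)) (P₂ q) = inner ℝ (P₁ p) (P₁ (B q)))
    (htri : ∀ n p, (∀ k, n < k → p.coeff k = 0) →
      (A (B p)).coeff n = κ n * p.coeff n ∧ ∀ k, n < k → (A (B p)).coeff k = 0)
    (hκ : ∀ n, c ≤ κ n) (q : ℝ[X]) : c * ‖P₂ q‖ ^ 2 ≤ ‖P₁ (B q)‖ ^ 2 := by
  have hlow : ∀ n, ∀ p ∈ degreeLT ℝ n, A (B p) ∈ degreeLT ℝ n := by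
    intro n p hp
    rw [mem_degreeLT, degree_lt_iff_coeff_zero] at hp ⊢
    cases n with
    | zero =>
      have : p = 0 := by ext k; simpa using hp k (Nat.zero_le k)
      simp [this]
    | succ n => exact (htri n p hp).2
  suffices h : ∀ n, ∀ q ∈ degreeLT ℝ n, c * ‖P₂ q‖ ^ 2 ≤ ‖P₁ (B q)‖ ^ 2 from
    h (q.natDegree + 1) q (by
      rw [mem_degreeLT, degree_lt_iff_coeff_zero]
      exact fun k hk => coeff_eq_zero_of_natDegree_lt hk)
  intro n
  induction n with
  | zero =>
    intro q hq
    rw [mem_degreeLT, degree_lt_iff_coeff_zero] at hq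
    have : q = 0 := by ext k; simpa using hq k (Nat.zero_le k)
    simp [this]
  | succ n ih =>
    intro q hq
    set S := (degreeLT ℝ n).map P₂
    obtain ⟨l, hl, hlS⟩ : ∃ l ∈ degreeLT ℝ n, P₂ l = S.starProjection (P₂ (X ^ n)) :=
      Submodule.mem_map.1 (S.starProjection_apply_mem _)
    -- The monic orthogonal polynomial of degree n for the form induced by `P₂`. The form need not
    -- be definite, so `P₂ e` may be zero.
    set e : ℝ[X] := X ^ n - l
    have he : ∀ p ∈ degreeLT ℝ n, inner ℝ (P₂ p) (P₂ e) = 0 := fun p hp => by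
      rw [map_sub, hlS]
      exact S.sub_starProjection_mem_orthogonal _ _ (Submodule.mem_map_of_mem hp)
    rw [mem_degreeLT, degree_lt_iff_coeff_zero] at hl hq
    have hen : e.coeff n = 1 := by simp [e, hl n le_rfl]
    have hek : ∀ k, n < k → e.coeff k = 0 := fun k hk => by
      simp [e, coeff_X_pow, hl k hk.le, hk.ne']
    set a := q.coeff n
    set q' := q - a • e
    have hq' : q' ∈ degreeLT ℝ n := by
      rw [mem_degreeLT, degree_lt_iff_coeff_zero]
      intro k hk
      rcases hk.eq_or_lt with rfl | hk
      · simp [q', a, hen]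
      · simp [q', hek k hk, hq k hk]
    have hqe : q = a • e + q' := by simp [q']
    -- By adjointness this pairs A B q', of degree below n, with the orthogonal polynomial `e`.
    have h1 : inner ℝ (P₁ (B e)) (P₁ (B q')) = 0 := by
      rw [real_inner_comm, ← hadj]
      exact he _ (hlow n q' hq')
    -- A B e equals κ n e up to lower degree, which is orthogonal to `e`.
    have h2 : ‖P₁ (B e)‖ ^ 2 = κ n * ‖P₂ e‖ ^ 2 := by
      rw [← real_inner_self_eq_norm_sq, ← hadj, ← real_inner_self_eq_norm_sq]
      obtain ⟨h3, h4⟩ := htri n e hek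
      have h5 : A (B e) - κ n • e ∈ degreeLT ℝ n := by
        rw [mem_degreeLT, degree_lt_iff_coeff_zero]
        intro k hk
        rcases hk.eq_or_lt with rfl | hk
        · simp [h3]
        · simp [hek k hk, h4 k hk]
      have h6 := he _ h5
      rw [map_sub, map_smul, inner_sub_left, real_inner_smul_left] at h6
      linarith
    have e1 : ‖P₂ q‖ ^ 2 = a ^ 2 * ‖P₂ e‖ ^ 2 + ‖P₂ q'‖ ^ 2 := by
      rw [hqe, map_add, map_smul, norm_add_sq_real, real_inner_smul_left, real_inner_comm,
        he q' hq', norm_smul, mul_pow, Real.norm_eq_abs, sq_abs]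
      ring
    have e2 : ‖P₁ (B q)‖ ^ 2 = a ^ 2 * ‖P₁ (B e)‖ ^ 2 + ‖P₁ (B q')‖ ^ 2 := by
      rw [hqe, map_add, map_smul, map_add, map_smul, norm_add_sq_real, real_inner_smul_left, h1,
        norm_smul, mul_pow, Real.norm_eq_abs, sq_abs]
      ring
    rw [e1, e2, h2]
    have h7 := ih q' hq'
    have h8 := mul_le_mul_of_nonneg_right (hκ n) (show 0 ≤ a ^ 2 * ‖P₂ e‖ ^ 2 by positivity)
    linarith

/-- Solvability of the dual problem from a lower bound. -/
lemma exists_inner_eq_of_lower_bound [CompleteSpace H₁] {V : Type*} [AddCommGroup V] [Module ℝ V]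
    (T : V →ₗ[ℝ] H₁) (P : V →ₗ[ℝ] H₂) {c : ℝ} (hc : 0 < c)
    (h : ∀ q, c * ‖P q‖ ^ 2 ≤ ‖T q‖ ^ 2) (f : H₂) :
    ∃ g : H₁, ∀ q, inner ℝ g (T q) = inner ℝ f (P q) := by
  have hP : ∀ q, ‖P q‖ ≤ (Real.sqrt c)⁻¹ * ‖T q‖ := fun q => by
    have h1 := Real.sqrt_le_sqrt (h q)
    rw [Real.sqrt_mul hc.le, Real.sqrt_sq (norm_nonneg _), Real.sqrt_sq (norm_nonneg _)] at h1
    rwa [inv_mul_eq_div, le_div_iff₀ (Real.sqrt_pos.2 hc), mul_comm]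
  set φ : Module.Dual ℝ V := (innerₛₗ ℝ f).comp P
  -- The lower bound gives ker T ⊆ ker P, so the functional q ↦ ⟨f, P q⟩ factors through T; the same
  -- bound makes the factor continuous on the range of T.
  have hφ : φ ∈ LinearMap.range T.dualMap := by
    rw [LinearMap.range_dualMap_eq_dualAnnihilator_ker, Submodule.mem_dualAnnihilator]
    intro q hq
    have h1 := hP q
    rw [LinearMap.mem_ker.1 hq, norm_zero, mul_zero] at h1
    simp [φ, norm_le_zero_iff.1 h1]
  obtain ⟨ψ, hψ⟩ := hφ
  have hψ' : ∀ q, ψ (T q) = inner ℝ f (P q) := fun q => by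
    rw [← LinearMap.dualMap_apply, hψ]; rfl
  set ψS : StrongDual ℝ (LinearMap.range T) :=
    (ψ.comp (LinearMap.range T).subtype).mkContinuous (‖f‖ * (Real.sqrt c)⁻¹) (by
      rintro ⟨_, q, rfl⟩
      change ‖ψ (T q)‖ ≤ _ * ‖T q‖
      rw [hψ', mul_assoc]
      exact (norm_inner_le_norm _ _).trans (mul_le_mul_of_nonneg_left (hP q) (norm_nonneg _)))
  obtain ⟨Ψ, hΨ, -⟩ := exists_extension_norm_eq _ ψS
  refine ⟨(InnerProductSpace.toDual ℝ H₁).symm Ψ, fun q => ?_⟩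
  rw [InnerProductSpace.toDual_symm_apply, ← hψ']
  exact hΨ ⟨T q, q, rfl⟩

end HilbertSpace

/-! ### Weighted L² spaces and the weighted derivative -/

lemma rho_half_mul_self (a b : ℝ) {x : ℝ} (hx : x ∈ Ioo (0 : ℝ) 1) :
    rho (a / 2) (b / 2) x * rho (a / 2) (b / 2) x = rho a b x := by
  have h1 : 0 < 1 - x := by linarith [hx.2]
  have e1 : (1 - x) ^ (a / 2) * (1 - x) ^ (a / 2) = (1 - x) ^ a := by
    rw [← Real.rpow_add h1, add_halves]
  have e2 : x ^ (b / 2) * x ^ (b / 2) = x ^ b := by rw [← Real.rpow_add hx.1, add_halves]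
  simp only [rho]
  rw [← e1, ← e2]
  ring

@[fun_prop]
lemma measurable_rho (a b : ℝ) : Measurable (rho a b) := by
  unfold rho
  fun_prop

lemma memLp_rho_half_mul {a b : ℝ} {v : ℝ → ℝ} (hv : AEStronglyMeasurable v unitVol)
    (h : Integrable (fun x => rho a b x * v x ^ 2) unitVol) :
    MemLp (fun x => rho (a / 2) (b / 2) x * v x) 2 unitVol := by
  refine (memLp_two_iff_integrable_sq (f := fun x => rho (a / 2) (b / 2) x * v x)
    ((measurable_rho _ _).aestronglyMeasurable.mul hv)).2 ?_
  refine IntegrableOn.congr_fun h (fun x hx => ?_) measurableSet_Ioo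
  rw [← rho_half_mul_self a b hx]
  ring

lemma memLp_rho_half_mul_eval {a b : ℝ} (h : Integrable (rho a b) unitVol)
    (p : Polynomial ℝ) : MemLp (fun x => rho (a / 2) (b / 2) x * p.eval x) 2 unitVol :=
  memLp_rho_half_mul p.continuous.aestronglyMeasurable
    (h.mul_continuous_unitVol (p.continuous.pow 2).continuousOn)

/-- Polynomials as elements of a weighted `L²` space, realised inside the unweighted one. -/
def polyLp {a b : ℝ} (h : Integrable (rho a b) unitVol) : Polynomial ℝ →ₗ[ℝ] Lp ℝ 2 unitVol where
  toFun p := (memLp_rho_half_mul_eval h p).toLp _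
  map_add' p q := by
    rw [← MemLp.toLp_add]
    congr 1
    ext x
    simp [mul_add]
  map_smul' c p := by
    rw [RingHom.id_apply, ← MemLp.toLp_const_smul]
    congr 1
    ext x
    simp [mul_left_comm]

lemma inner_Lp_polyLp {a b : ℝ} (h : Integrable (rho a b) unitVol) (g : Lp ℝ 2 unitVol)
    (p : Polynomial ℝ) :
    inner ℝ g (polyLp h p) = ∫ x, (rho (a / 2) (b / 2) x * g x) * p.eval x ∂unitVol := by
  rw [L2.inner_def]
  refine integral_congr_ae ?_
  filter_upwards [(memLp_rho_half_mul_eval h p).coeFn_toLp] with x hx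
  change inner ℝ (g x) ((memLp_rho_half_mul_eval h p).toLp _ x) = _
  rw [hx, real_inner_eq_re_inner]
  simp
  ring

lemma inner_toLp_polyLp {a b : ℝ} (h : Integrable (rho a b) unitVol) {v : ℝ → ℝ}
    (hv : MemLp (fun x => rho (a / 2) (b / 2) x * v x) 2 unitVol) (p : Polynomial ℝ) :
    inner ℝ (hv.toLp _) (polyLp h p) = ∫ x, rho a b x * v x * p.eval x ∂unitVol := by
  rw [inner_Lp_polyLp]
  refine integral_congr_ae ?_
  filter_upwards [hv.coeFn_toLp, ae_restrict_mem measurableSet_Ioo] with x hx hx1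
  rw [hx, ← mul_assoc, rho_half_mul_self a b hx1]

lemma inner_polyLp_polyLp {a b : ℝ} (h : Integrable (rho a b) unitVol) (p q : Polynomial ℝ) :
    inner ℝ (polyLp h p) (polyLp h q) = ∫ x, rho a b x * p.eval x * q.eval x ∂unitVol :=
  inner_toLp_polyLp h (memLp_rho_half_mul_eval h p) q

lemma hasDerivAt_rho_mul (a b : ℝ) {x : ℝ} (hx : x ∈ Ioo (0 : ℝ) 1) {q : ℝ → ℝ} {q' : ℝ}
    (hq : HasDerivAt q q' x) :
    HasDerivAt (fun y => rho b a y * q y)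
      (rho (b - 1) (a - 1) x * ((a * (1 - x) - b * x) * q x + x * (1 - x) * q')) x := by
  have h1 : 0 < 1 - x := by linarith [hx.2]
  have d1 := ((hasDerivAt_id x).const_sub 1).rpow_const (p := b) (Or.inl h1.ne')
  have d2 := (hasDerivAt_id x).rpow_const (p := a) (Or.inl hx.1.ne')
  refine ((d1.mul d2).mul hq).congr_deriv ?_
  have e1 : (1 - x) ^ b = (1 - x) ^ (b - 1) * (1 - x) := by
    rw [Real.rpow_sub_one h1.ne', div_mul_cancel₀ _ h1.ne']
  have e2 : x ^ a = x ^ (a - 1) * x := by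
    rw [Real.rpow_sub_one hx.1.ne', div_mul_cancel₀ _ hx.1.ne']
  simp only [rho, Pi.mul_apply, id]
  rw [e1, e2]
  ring

lemma continuous_rho {a b : ℝ} (ha : 0 < a) (hb : 0 < b) : Continuous (rho b a) := by
  unfold rho
  exact ((continuous_const.sub continuous_id).rpow_const fun _ => Or.inr hb.le).mul
    (continuous_id.rpow_const fun _ => Or.inr ha.le)

/-- Integration by parts against the weight `rho b a`, which vanishes at both end points. -/
lemma integral_rho_mul_deriv {a b : ℝ} (ha : 0 < a) (hb : 0 < b) {q q' : ℝ → ℝ}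
    (hq : ∀ x, HasDerivAt q (q' x) x) (hq' : Continuous q') :
    ∫ x, rho (b - 1) (a - 1) x * ((a * (1 - x) - b * x) * q x + x * (1 - x) * q' x) ∂unitVol =
      0 := by
  have hqc : Continuous q := continuous_iff_continuousAt.2 fun x => (hq x).continuousAt
  rw [← intervalIntegral_eq_unitVol, intervalIntegral.integral_eq_sub_of_hasDerivAt_of_le
    zero_le_one ((continuous_rho ha hb).mul hqc).continuousOn
    (fun x hx => hasDerivAt_rho_mul a b hx (hq x))]
  · simp [rho, Real.zero_rpow ha.ne', Real.zero_rpow hb.ne']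
  · rw [intervalIntegrable_iff_unitVol]
    refine (integrable_rho hb ha).mul_continuous_unitVol (Continuous.continuousOn ?_)
    fun_prop

open Polynomial in
/-- `(rho b a * q)' = rho (b - 1) (a - 1) * rhoDeriv a b q`. -/
def rhoDeriv (a b : ℝ) : ℝ[X] →ₗ[ℝ] ℝ[X] :=
  LinearMap.mulLeft ℝ (Polynomial.C a * (1 - X) - Polynomial.C b * X) +
    (LinearMap.mulLeft ℝ (X * (1 - X))).comp derivative

lemma eval_rhoDeriv (a b x : ℝ) (q : Polynomial ℝ) : (rhoDeriv a b q).eval x =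
    (a * (1 - x) - b * x) * q.eval x + x * (1 - x) * (Polynomial.derivative q).eval x := by
  simp [rhoDeriv, mul_assoc]

open Polynomial in
-- The degree goes up by one; the ordinary derivative in the adjoint operator brings it back down,
-- which is why their composition is triangular.
lemma coeff_rhoDeriv (a b : ℝ) (n : ℕ) (q : ℝ[X]) (hq : ∀ k, n < k → q.coeff k = 0) :
    (rhoDeriv a b q).coeff (n + 1) = -(a + b + n) * q.coeff n ∧
      ∀ k, n + 1 < k → (rhoDeriv a b q).coeff k = 0 := by
  have e : rhoDeriv a b q = Polynomial.C a * q - Polynomial.C (a + b) * (X * q) +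
      (X * derivative q - X * (X * derivative q)) := by
    simp only [rhoDeriv, LinearMap.add_apply, LinearMap.comp_apply, LinearMap.mulLeft_apply, C_add]
    ring
  have hx : ∀ k, (X * (X * derivative q)).coeff (k + 1) = q.coeff k * k := fun k => by
    rw [coeff_X_mul]
    cases k with
    | zero => simp
    | succ k => rw [coeff_X_mul, coeff_derivative]; push_cast; ring
  have key : ∀ k, (rhoDeriv a b q).coeff (k + 1) =
      a * q.coeff (k + 1) - (a + b) * q.coeff k + (q.coeff (k + 1) * (k + 1) - q.coeff k * k) :=
    fun k => by
      rw [e, coeff_add, coeff_sub, coeff_sub, hx, coeff_C_mul, coeff_C_mul, coeff_X_mul,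
        coeff_X_mul, coeff_derivative]
  refine ⟨by rw [key, hq (n + 1) (by omega)]; ring, fun k hk => ?_⟩
  obtain ⟨k, rfl⟩ := Nat.exists_eq_add_one_of_ne_zero (show k ≠ 0 by omega)
  rw [key, hq k (by omega), hq (k + 1) (by omega)]
  ring

/-! ### Existence -/

/-- The equation tested with polynomial multiples of the weight. -/
lemma exists_integral_kint_mul_rhoDeriv {α r a b : ℝ} (hα₁ : 1 < α) (hα₂ : α < 2) (hr₀ : 0 ≤ r)
    (hr₁ : r ≤ 1) (h : Balanced α r a b) {f : ℝ → ℝ}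
    (hf : MemLp (fun x => rho (b / 2) (a / 2) x * f x) 2 unitVol) :
    ∃ g : ℝ → ℝ, Integrable g unitVol ∧ ∫ x, g x ∂unitVol = 0 ∧ ∀ q : Polynomial ℝ,
      ∫ x, kint α r g x * (rho (b - 1) (a - 1) x * (rhoDeriv a b q).eval x) ∂unitVol =
        ∫ x, rho b a x * f x * q.eval x ∂unitVol := by
  obtain ⟨ha, -, hb, -, hab, -⟩ := id h
  obtain ⟨C, hC0, hC⟩ := kint_rho_eq_const hα₁ hα₂ hr₀ hr₁ h
  obtain ⟨C', hC0', hC'⟩ := kint_rho_eq_const hα₁ hα₂ (sub_nonneg.2 hr₁) (by linarith) h.swap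
  obtain ⟨J, hJ, hJn⟩ := exists_linearMap_kint hα₁ hα₂ ha hb hC
  obtain ⟨J', hJ', hJn'⟩ := exists_linearMap_kint hα₁ hα₂ hb ha hC'
  have hφ := integrable_rho ha hb
  have hρ : Integrable (rho b a) unitVol := by
    simpa using integrable_rho (a := b + 1) (b := a + 1) (by linarith) (by linarith)
  -- Formally `A` p = -(K (φ p))' and `B` q = K* ((ρ q)'), where φ = `rho (a - 1) (b - 1)`, ρ = `rho
  -- b a` and K* is the transpose of K. They are adjoint between the L² spaces with weights φ and ρ.
  set A : Polynomial ℝ →ₗ[ℝ] Polynomial ℝ := -(Polynomial.derivative.comp J)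
  set B : Polynomial ℝ →ₗ[ℝ] Polynomial ℝ := J'.comp (rhoDeriv a b)
  have hpair : ∀ g, Integrable g unitVol → ∀ q : Polynomial ℝ,
      ∫ x, kint α r g x * (rho (b - 1) (a - 1) x * (rhoDeriv a b q).eval x) ∂unitVol =
        ∫ x, g x * (B q).eval x ∂unitVol := by
    intro g hg q
    rw [integral_kint_mul_rho hα₁ hα₂ hr₀ hr₁ h hg (rhoDeriv a b q).continuous]
    refine integral_congr_ae ?_
    filter_upwards [hJ' (rhoDeriv a b q)] with x hx
    rw [hx]
    rfl
  have hparts : ∀ p q : Polynomial ℝ,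
      ∫ x, rho (b - 1) (a - 1) x * (p * rhoDeriv a b q).eval x ∂unitVol =
        ∫ x, rho b a x * (-Polynomial.derivative p).eval x * q.eval x ∂unitVol := by
    intro p q
    have h1 := integral_rho_mul_deriv ha hb (fun x => (p * q).hasDerivAt x)
      (p * q).derivative.continuous
    rw [← sub_eq_zero, ← h1, ← integral_sub]
    · refine setIntegral_congr_fun measurableSet_Ioo fun x hx => ?_
      have e : rho b a x = rho (b - 1) (a - 1) x * (x * (1 - x)) := by
        have h2 : 1 - x ≠ 0 := by linarith [hx.2]
        have h3 : x ≠ 0 := hx.1.ne'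
        simp only [rho]
        rw [Real.rpow_sub_one h2, Real.rpow_sub_one h3]
        field_simp
      simp only [e, Polynomial.eval_mul, eval_rhoDeriv, Polynomial.derivative_mul,
        Polynomial.eval_add, Polynomial.eval_neg]
      ring
    · exact (integrable_rho hb ha).mul_continuous_unitVol
        (p * rhoDeriv a b q).continuous.continuousOn
    · exact (hρ.mul_continuous_unitVol (-Polynomial.derivative p).continuous.continuousOn
        ).mul_continuous_unitVol q.continuous.continuousOn
  have hadj : ∀ p q, inner ℝ (polyLp hρ (A p)) (polyLp hρ q) =
      inner ℝ (polyLp hφ p) (polyLp hφ (B q)) := by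
    intro p q
    rw [inner_polyLp_polyLp, inner_polyLp_polyLp, ← hpair _
      (hφ.mul_continuous_unitVol p.continuous.continuousOn) q]
    refine (hparts (J p) q).symm.trans (integral_congr_ae ?_)
    filter_upwards [hJ p] with x hx
    rw [hx, Polynomial.eval_mul]
    ring
  -- One factor `leadCoef α (n + 1)` comes from each of `J` and `J'`, n + α from `rhoDeriv` with a +
  -- b = α, and n + 1 from differentiation; the two minus signs cancel.
  set κ : ℕ → ℝ := fun n =>
    C * C' * ((n + 1 : ℝ) * leadCoef α (n + 1)) * ((n + α) * leadCoef α (n + 1))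
  have htri : ∀ n p, (∀ k, n < k → p.coeff k = 0) →
      (A (B p)).coeff n = κ n * p.coeff n ∧ ∀ k, n < k → (A (B p)).coeff k = 0 := by
    intro n p hp
    obtain ⟨h1, h2⟩ := coeff_rhoDeriv a b n p hp
    obtain ⟨h3, h4⟩ := hJn' (n + 1) _ h2
    obtain ⟨h5, h6⟩ := hJn (n + 1) _ h4
    simp only [A, B, LinearMap.neg_apply, LinearMap.comp_apply, Polynomial.coeff_neg,
      Polynomial.coeff_derivative]
    refine ⟨?_, fun k hk => by rw [h6 (k + 1) (by omega)]; simp⟩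
    rw [h5, h3, h1, hab]
    simp only [κ]
    ring
  have hκ : ∀ n, C * C' * (α - 1) * (α - 1) ≤ κ n := by
    intro n
    have h1 := le_succ_mul_leadCoef_succ hα₁ n
    have h2 := leadCoef_pos hα₁ (n + 1)
    have h3 : α - 1 ≤ ((n : ℝ) + α) * leadCoef α (n + 1) := h1.trans (by nlinarith)
    have h4 : 0 < α - 1 := by linarith
    simp only [κ]
    rw [mul_assoc (C * C'), mul_assoc (C * C')]
    exact mul_le_mul_of_nonneg_left (mul_le_mul h1 h3 h4.le (h4.le.trans h1)) (by positivity)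
  obtain ⟨w, hw⟩ := exists_inner_eq_of_lower_bound ((polyLp hφ).comp B) (polyLp hρ)
    (by have : 0 < α - 1 := by linarith
        positivity)
    (mul_norm_sq_le_of_triangular (polyLp hφ) (polyLp hρ) A B κ _ hadj htri hκ) (hf.toLp _)
  -- The other half of the weight sits inside `polyLp`, so the inner product with w becomes an
  -- unweighted pairing with `g₀`, which is integrable by Cauchy-Schwarz.
  set g₀ : ℝ → ℝ := fun x => rho ((a - 1) / 2) ((b - 1) / 2) x * w x
  have hg₀ : Integrable g₀ unitVol := by
    have := memLp_rho_half_mul_eval hφ 1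
    simp only [Polynomial.eval_one, mul_one] at this
    exact this.integrable_mul (Lp.memLp w)
  have hφ0 : 0 < ∫ x, rho (a - 1) (b - 1) x ∂unitVol := by
    rw [← intervalIntegral_eq_unitVol]
    exact intervalIntegral.intervalIntegral_pos_of_pos_on (intervalIntegrable_iff_unitVol.2 hφ)
      (fun x hx => rho_pos _ _ hx) zero_lt_one
  -- Chosen to give g mean zero, hence u(1) = 0. The correction changes K g by the constant `c * C`,
  -- which is orthogonal to every weighted derivative (`hparts` with p = 1).
  set c := -((∫ x, g₀ x ∂unitVol) / ∫ x, rho (a - 1) (b - 1) x ∂unitVol)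
  refine ⟨fun x => g₀ x + c * rho (a - 1) (b - 1) x, hg₀.add (hφ.const_mul c), ?_, fun q => ?_⟩
  · rw [integral_add hg₀ (hφ.const_mul c), integral_const_mul]
    simp only [c]
    field_simp
    ring
  · have h1 := hw q
    rw [inner_toLp_polyLp, LinearMap.comp_apply, inner_Lp_polyLp, ← hpair g₀ hg₀] at h1
    rw [← h1]
    have h2 := hparts 1 q
    simp only [one_mul, Polynomial.derivative_one, neg_zero, Polynomial.eval_zero, mul_zero,
      zero_mul, integral_zero] at h2
    have h3 : ∫ x, kint α r g₀ x * (rho (b - 1) (a - 1) x * (rhoDeriv a b q).eval x) +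
        c * C * (rho (b - 1) (a - 1) x * (rhoDeriv a b q).eval x) ∂unitVol =
        ∫ x, kint α r g₀ x * (rho (b - 1) (a - 1) x * (rhoDeriv a b q).eval x) ∂unitVol := by
      rw [integral_add (integrable_kint_mul_rho hα₁ hα₂ hr₀ hr₁ h hg₀ (rhoDeriv a b q).continuous)
        (((integrable_rho hb ha).mul_continuous_unitVol
          (rhoDeriv a b q).continuous.continuousOn).const_mul _), integral_const_mul, h2]
      ring
    rw [← h3]
    refine integral_congr_ae ?_
    filter_upwards [kint_add_ae hα₁ hα₂ r hg₀ (hφ.const_mul c), hC] with x h4 h5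
    rw [h4, kint_const_mul, h5]
    ring

lemma contDiffAt_rho (a b : ℝ) {x : ℝ} (hx : x ∈ Ioo (0 : ℝ) 1) (n : ℕ∞) :
    ContDiffAt ℝ n (rho b a) x :=
  ((contDiffAt_const.sub contDiffAt_id).rpow_const_of_ne (by simp; linarith [hx.2])).mul
    (contDiffAt_id.rpow_const_of_ne hx.1.ne')

/-- The support of ψ is a closed subset of (0,1), where the weight is smooth and positive; off the
support the quotient is locally zero. -/
lemma IsTest.contDiff_div_rho {ψ : ℝ → ℝ} (hψ : IsTest ψ) (a b : ℝ) :
    ContDiff ℝ 1 (fun x => ψ x / rho b a x) := by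
  rw [contDiff_iff_contDiffAt]
  intro x
  by_cases hx : x ∈ tsupport ψ
  · exact (hψ.1.of_le (by simp)).contDiffAt.fun_div (contDiffAt_rho a b (hψ.2 hx) 1)
      (rho_pos _ _ (hψ.2 hx)).ne'
  · refine (contDiffAt_const (c := 0)).congr_of_eventuallyEq ?_
    filter_upwards [(isClosed_tsupport ψ).isOpen_compl.mem_nhds hx] with y hy
    rw [image_eq_zero_of_notMem_tsupport hy, zero_div]

/-- Polynomial multiples of the weight suffice to test the equation. -/
lemma integral_mul_deriv_eq_of_rhoDeriv {a b : ℝ} (ha : 0 < a) (hb : 0 < b) (ha1 : a ≤ 1)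
    (hb1 : b ≤ 1) {k f : ℝ → ℝ}
    (hk : Integrable (fun x => k x * rho (b - 1) (a - 1) x) unitVol)
    (hf : Integrable (fun x => rho b a x * f x) unitVol)
    (h : ∀ q : Polynomial ℝ, ∫ x, k x * (rho (b - 1) (a - 1) x * (rhoDeriv a b q).eval x) ∂unitVol =
        ∫ x, rho b a x * f x * q.eval x ∂unitVol) {ψ : ℝ → ℝ} (hψ : IsTest ψ) :
    ∫ x, k x * deriv ψ x ∂unitVol = ∫ x, f x * ψ x ∂unitVol := by
  set χ : ℝ → ℝ := fun x => ψ x / rho b a x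
  have hχ : ContDiff ℝ 1 χ := hψ.contDiff_div_rho a b
  have hχd : ∀ x, HasDerivAt χ (deriv χ x) x := fun x =>
    (hχ.differentiable one_ne_zero x).hasDerivAt
  have hχ' : Continuous (deriv χ) := hχ.continuous_deriv le_rfl
  have hχ0 : χ 0 = 0 := by simp [χ, hψ.eq_zero (x := 0) (by simp)]
  set D : ℝ → ℝ := fun x => (a * (1 - x) - b * x) * χ x + x * (1 - x) * deriv χ x
  have hχc : Continuous χ := hχ.continuous
  have hD : Continuous D := by fun_prop
  have hψχ : ∀ x ∈ Ioo (0 : ℝ) 1, rho b a x * χ x = ψ x := fun x hx =>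
    mul_div_cancel₀ _ (rho_pos b a hx).ne'
  have hψ' : ∀ x ∈ Ioo (0 : ℝ) 1, deriv ψ x = rho (b - 1) (a - 1) x * D x := fun x hx => by
    rw [← (hasDerivAt_rho_mul a b hx (hχd x)).deriv]
    refine EventuallyEq.deriv_eq ?_
    filter_upwards [isOpen_Ioo.mem_nhds hx] with y hy using (hψχ y hy).symm
  have e1 : ∫ x, k x * deriv ψ x ∂unitVol =
      ∫ x, k x * rho (b - 1) (a - 1) x * D x ∂unitVol :=
    setIntegral_congr_fun measurableSet_Ioo fun x hx => by simp only [hψ' x hx, mul_assoc]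
  have e2 : ∫ x, f x * ψ x ∂unitVol = ∫ x, rho b a x * f x * χ x ∂unitVol :=
    setIntegral_congr_fun measurableSet_Ioo fun x hx => by simp only [← hψχ x hx]; ring
  rw [e1, e2, ← sub_eq_zero]
  set M := ∫ x, ‖k x * rho (b - 1) (a - 1) x‖ ∂unitVol
  set N := ∫ x, ‖rho b a x * f x‖ ∂unitVol
  have hM : 0 ≤ M := integral_nonneg fun _ => norm_nonneg _
  have hN : 0 ≤ N := integral_nonneg fun _ => norm_nonneg _
  refine norm_le_zero_iff.1 (le_of_forall_pos_le_add fun ε' hε' => ?_)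
  -- A polynomial ε-close to χ' has a primitive q ε-close to χ. As a, b ≤ 1, the coefficients in
  -- `rhoDeriv` are at most 1 in absolute value, so the two errors are at most 2ε M and ε N.
  set ε := ε' / (2 * M + N + 1)
  have hε : 0 < ε := by positivity
  obtain ⟨p, hp⟩ := exists_polynomial_near_of_continuousOn 0 1 (deriv χ) hχ'.continuousOn ε hε
  obtain ⟨q, hqp, hq0⟩ := exists_derivative_eq p
  have hq1 : ∀ x ∈ Icc (0 : ℝ) 1, |deriv χ x - q.derivative.eval x| ≤ ε := fun x hx => by
    rw [hqp, abs_sub_comm]; exact (hp x hx).le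
  have hq2 : ∀ x ∈ Icc (0 : ℝ) 1, |χ x - q.eval x| ≤ ε := fun x hx => by
    have h1 := intervalIntegral.norm_integral_le_of_norm_le_const (a := 0) (b := x) (C := ε)
      (f := fun t => deriv χ t - q.derivative.eval t) (fun t ht => by
        rw [uIoc_of_le hx.1] at ht
        exact hq1 t ⟨ht.1.le, ht.2.trans hx.2⟩)
    rw [intervalIntegral.integral_sub (hχ'.intervalIntegrable _ _)
      (q.derivative.continuous.intervalIntegrable _ _), integral_eval_derivative, hq0,
      intervalIntegral.integral_eq_sub_of_hasDerivAt (fun t _ => hχd t)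
        (hχ'.intervalIntegrable _ _), hχ0, sub_zero, sub_zero, sub_zero, abs_of_nonneg hx.1] at h1
    exact h1.trans (by nlinarith [hx.2])
  have hq3 : ∀ x ∈ Icc (0 : ℝ) 1, |D x - (rhoDeriv a b q).eval x| ≤ 2 * ε := fun x hx => by
    have h1 := hq1 x hx
    have h2 := hq2 x hx
    have e : D x - (rhoDeriv a b q).eval x = (a * (1 - x) - b * x) * (χ x - q.eval x) +
        x * (1 - x) * (deriv χ x - q.derivative.eval x) := by
      rw [eval_rhoDeriv]; ring
    have h3 : |a * (1 - x) - b * x| ≤ 1 := by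
      rw [abs_le]; constructor <;> nlinarith [hx.1, hx.2]
    have h4 : |x * (1 - x)| ≤ 1 := by
      rw [abs_le]; constructor <;> nlinarith [hx.1, hx.2]
    rw [e]
    refine (abs_add_le _ _).trans ?_
    rw [abs_mul, abs_mul]
    have h5 := mul_le_mul h3 h2 (abs_nonneg _) zero_le_one
    have h6 := mul_le_mul h4 h1 (abs_nonneg _) zero_le_one
    linarith
  have e3 : ∫ x, k x * rho (b - 1) (a - 1) x * D x ∂unitVol - ∫ x, rho b a x * f x * χ x ∂unitVol =
      ∫ x, k x * rho (b - 1) (a - 1) x * (D x - (rhoDeriv a b q).eval x) ∂unitVol -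
        ∫ x, rho b a x * f x * (χ x - q.eval x) ∂unitVol := by
    simp only [mul_sub]
    rw [integral_sub (hk.mul_continuous_unitVol hD.continuousOn)
      (hk.mul_continuous_unitVol (rhoDeriv a b q).continuous.continuousOn),
      integral_sub (hf.mul_continuous_unitVol hχc.continuousOn)
      (hf.mul_continuous_unitVol q.continuous.continuousOn), ← h q]
    simp only [mul_assoc]
    ring
  have b1 : ‖∫ x, k x * rho (b - 1) (a - 1) x * (D x - (rhoDeriv a b q).eval x) ∂unitVol‖ ≤
      M * (2 * ε) := by
    rw [← integral_mul_const]
    refine norm_integral_le_of_norm_le (hk.norm.mul_const _) ?_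
    filter_upwards [ae_restrict_mem measurableSet_Ioo] with x hx
    rw [norm_mul]
    exact mul_le_mul_of_nonneg_left (hq3 x (Ioo_subset_Icc_self hx)) (norm_nonneg _)
  have b2 : ‖∫ x, rho b a x * f x * (χ x - q.eval x) ∂unitVol‖ ≤ N * ε := by
    rw [← integral_mul_const]
    refine norm_integral_le_of_norm_le (hf.norm.mul_const _) ?_
    filter_upwards [ae_restrict_mem measurableSet_Ioo] with x hx
    rw [norm_mul]
    exact mul_le_mul_of_nonneg_left (hq2 x (Ioo_subset_Icc_self hx)) (norm_nonneg _)
  rw [e3, zero_add]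
  refine (norm_sub_le _ _).trans ?_
  have : ε * (2 * M + N + 1) = ε' := div_mul_cancel₀ _ (by positivity)
  nlinarith

/-- Existence of a solution. -/
lemma exists_isSolution {α r a b : ℝ} (hα₁ : 1 < α) (hα₂ : α < 2) (hr₀ : 0 ≤ r)
    (hr₁ : r ≤ 1) (h : Balanced α r a b) {f : ℝ → ℝ} (hf : MemWeightedL2 b a f) :
    ∃ u, IsSolution α r f u := by
  obtain ⟨ha, ha1, hb, hb1, hab, -⟩ := id h
  have hρ : Integrable (rho b a) unitVol := by
    simpa using integrable_rho (a := b + 1) (b := a + 1) (by linarith) (by linarith)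
  have hfL := memLp_rho_half_mul hf.1 hf.2
  obtain ⟨g, hg, hg0, hgq⟩ := exists_integral_kint_mul_rhoDeriv hα₁ hα₂ hr₀ hr₁ h hfL
  have hfi : Integrable (fun x => rho b a x * f x) unitVol := by
    have h1 := memLp_rho_half_mul_eval hρ 1
    simp only [Polynomial.eval_one, mul_one] at h1
    refine IntegrableOn.congr_fun (h1.integrable_mul hfL) (fun x hx => ?_) measurableSet_Ioo
    simp only [Pi.mul_apply]
    rw [← mul_assoc, rho_half_mul_self b a hx]
  have hki : Integrable (fun x => kint α r g x * rho (b - 1) (a - 1) x) unitVol := by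
    simpa using integrable_kint_mul_rho hα₁ hα₂ hr₀ hr₁ h hg (q := fun _ => 1) continuous_const
  have hgI := intervalIntegrable_iff_unitVol.2 hg
  refine ⟨fun x => ∫ t in (0 : ℝ)..x, g t,
    hgI.absolutelyContinuousOnInterval_intervalIntegral (by simp), by simp, ?_, fun ψ hψ => ?_⟩
  · exact (intervalIntegral_eq_unitVol g).trans hg0
  · rw [intervalIntegral_eq_unitVol, intervalIntegral_eq_unitVol,
      ← integral_mul_deriv_eq_of_rhoDeriv ha hb ha1 hb1 hki hfi hgq hψ]
    have hd : deriv (fun x => ∫ t in (0 : ℝ)..x, g t) =ᵐ[unitVol] g := by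
      filter_upwards [ae_restrict_mem measurableSet_Ioo,
        ae_restrict_of_ae hgI.ae_hasDerivAt_integral] with x hx h'
      exact (h' (by rw [uIcc_of_le zero_le_one]; exact Ioo_subset_Icc_self hx) 0 (by simp)).deriv
    refine integral_congr_ae ?_
    filter_upwards [mixedInt_ae_eq_kint hα₁ hα₂ r (hg.congr hd.symm)] with x hx
    rw [hx, kint_congr_ae α r hd]

/-! ### Distributions with vanishing derivatives -/

lemma exists_isTest_integral_eq_one : ∃ θ, IsTest θ ∧ ∫ x, θ x ∂unitVol = 1 := by
  let φ : ContDiffBump (1 / 2 : ℝ) := ⟨1 / 8, 1 / 4, by norm_num, by norm_num⟩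
  have hs : tsupport (φ.normed volume) ⊆ Ioo (0 : ℝ) 1 := by
    rw [φ.tsupport_normed_eq, Real.closedBall_eq_Icc]
    intro x hx
    have h1 : φ.rOut = 1 / 4 := rfl
    rw [h1] at hx
    constructor <;> linarith [hx.1, hx.2]
  refine ⟨φ.normed volume, ⟨φ.contDiff_normed, hs⟩, ?_⟩
  rw [setIntegral_eq_integral_of_forall_compl_eq_zero, φ.integral_normed]
  exact fun x hx => image_eq_zero_of_notMem_tsupport fun hx' => hx (hs hx')

lemma IsTest.sub_const_mul {η θ : ℝ → ℝ} (hη : IsTest η) (hθ : IsTest θ) (c : ℝ) :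
    IsTest (fun x => η x - c * θ x) := by
  refine ⟨hη.1.sub (contDiff_const.mul hθ.1), ?_⟩
  have h1 : tsupport (fun x => η x - c * θ x) ⊆ tsupport η ∪ tsupport θ := by
    refine closure_minimal (fun x hx => ?_) ((isClosed_tsupport η).union (isClosed_tsupport θ))
    by_contra h
    rw [mem_union, not_or] at h
    apply hx
    simp [image_eq_zero_of_notMem_tsupport h.1, image_eq_zero_of_notMem_tsupport h.2]
  exact h1.trans (union_subset hη.2 hθ.2)

lemma exists_isTest_deriv_eq {η : ℝ → ℝ} (hη : IsTest η) (h0 : ∫ x, η x ∂unitVol = 0) :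
    ∃ ψ, IsTest ψ ∧ deriv ψ = η := by
  -- The extra point keeps `K` nonempty when η = 0, so that its infimum and supremum lie in (0,1).
  set K := insert (1 / 2 : ℝ) (tsupport η)
  have hKI : K ⊆ Ioo (0 : ℝ) 1 := insert_subset (by norm_num) hη.2
  have hK : IsCompact K := ((isCompact_Icc (a := (0 : ℝ)) (b := 1)).of_isClosed_subset
    (isClosed_tsupport η) (hη.2.trans Ioo_subset_Icc_self)).insert _
  have hKne : K.Nonempty := insert_nonempty _ _
  have hp := hKI (hK.sInf_mem hKne)
  have hq := hKI (hK.sSup_mem hKne)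
  set ψ : ℝ → ℝ := fun x => ∫ t in (0 : ℝ)..x, η t
  have hd : ∀ x, HasDerivAt ψ (η x) x := fun x =>
    (hη.continuous.integral_hasStrictDerivAt 0 x).hasDerivAt
  have hd' : deriv ψ = η := funext fun x => (hd x).deriv
  have hz1 : ∀ x, x < sInf K → η x = 0 := fun x hx => image_eq_zero_of_notMem_tsupport
    fun h => (csInf_le hK.bddBelow (mem_insert_of_mem _ h)).not_gt hx
  have hz2 : ∀ x, sSup K < x → η x = 0 := fun x hx => image_eq_zero_of_notMem_tsupport
    fun h => (le_csSup hK.bddAbove (mem_insert_of_mem _ h)).not_gt hx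
  refine ⟨ψ, ⟨contDiff_infty_iff_deriv.2 ⟨fun x => (hd x).differentiableAt, hd' ▸ hη.1⟩, ?_⟩, hd'⟩
  refine (closure_minimal (t := Icc (sInf K) (sSup K)) (fun x hx => ?_) isClosed_Icc).trans
    (Icc_subset_Ioo hp.1 hq.2)
  by_contra h
  rw [mem_Icc, not_and_or, not_le, not_le] at h
  apply hx
  rcases h with h | h
  · refine intervalIntegral.integral_zero_ae (.of_forall fun t ht => hz1 t ?_)
    have := (uIoc_subset_uIcc ht)
    exact lt_of_le_of_lt this.2 (max_lt hp.1 h)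
  · have h1 : ∫ t in x..1, η t = 0 :=
      intervalIntegral.integral_zero_ae (.of_forall fun t ht => hz2 t
        (lt_of_lt_of_le (lt_min h hq.2) (uIoc_subset_uIcc ht).1))
    have h2 := intervalIntegral.integral_add_adjacent_intervals (μ := volume)
      (hη.continuous.intervalIntegrable 0 x) (hη.continuous.intervalIntegrable x 1)
    rw [h1, add_zero, intervalIntegral_eq_unitVol, h0] at h2
    exact h2

/-- A linear functional on test functions that vanishes on derivatives is a multiple of the
integral. -/
lemma exists_eq_mul_integral {Λ : (ℝ → ℝ) → ℝ}
    (hΛ : ∀ η θ c, IsTest η → IsTest θ → Λ (fun x => η x - c * θ x) = Λ η - c * Λ θ)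
    (h : ∀ ψ, IsTest ψ → Λ (deriv ψ) = 0) :
    ∃ c, ∀ η, IsTest η → Λ η = c * ∫ x, η x ∂unitVol := by
  obtain ⟨θ, hθ, hθ1⟩ := exists_isTest_integral_eq_one
  have hint : ∀ η, IsTest η → Integrable η unitVol := fun η hη =>
    intervalIntegrable_iff_unitVol.1 (hη.continuous.intervalIntegrable 0 1)
  refine ⟨Λ θ, fun η hη => ?_⟩
  -- Subtracting (∫ η) θ leaves a test function of integral zero, which is the derivative of a test
  -- function.
  obtain ⟨ψ, hψ, hψ'⟩ := exists_isTest_deriv_eq (hη.sub_const_mul hθ (∫ x, η x ∂unitVol)) (by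
    rw [integral_sub (hint η hη) ((hint θ hθ).const_mul _), integral_const_mul, hθ1]
    ring)
  have h1 := h ψ hψ
  rw [hψ', hΛ _ _ _ hη hθ] at h1
  linarith

/-- An integrable function whose second distributional derivative vanishes is affine. -/
lemma ae_eq_affine_of_integral_mul_deriv_deriv {k : ℝ → ℝ} (hk : Integrable k unitVol)
    (h : ∀ ψ, IsTest ψ → ∫ x, k x * deriv (deriv ψ) x ∂unitVol = 0) :
    ∃ c₀ c₁ : ℝ, k =ᵐ[unitVol] fun x => c₀ + c₁ * x := by
  have hlin : ∀ k : ℝ → ℝ, Integrable k unitVol → ∀ η θ c, IsTest η → IsTest θ →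
      ∫ x, k x * (η x - c * θ x) ∂unitVol =
        ∫ x, k x * η x ∂unitVol - c * ∫ x, k x * θ x ∂unitVol := fun k hk η θ c hη hθ => by
    rw [← integral_const_mul, ← integral_sub (hη.integrable_mul hk)
      ((hθ.integrable_mul hk).const_mul c)]
    refine integral_congr_ae (.of_forall fun x => ?_)
    simp only
    ring
  obtain ⟨c, hc⟩ := exists_eq_mul_integral (Λ := fun ψ => ∫ x, k x * deriv ψ x ∂unitVol)
    (fun η θ c hη hθ => by
      have : deriv (fun x => η x - c * θ x) = fun x => deriv η x - c * deriv θ x := by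
        ext x
        have h1 := (hη.1.differentiable (by simp) x).hasDerivAt
        have h2 := (hθ.1.differentiable (by simp) x).hasDerivAt
        exact (h1.fun_sub (h2.const_mul c)).deriv
      simp only [this]
      exact hlin k hk _ _ c hη.deriv hθ.deriv) h
  have hx : Integrable (fun x : ℝ => c * x) unitVol :=
    intervalIntegrable_iff_unitVol.1 ((by fun_prop : Continuous fun x : ℝ => c * x
      ).intervalIntegrable 0 1)
  have hkx : Integrable (fun x => k x + c * x) unitVol := hk.add hx
  -- The first application gave ∫ k ψ' = c ∫ ψ. Since ∫ x ψ' = -∫ ψ, the function k + c x has zero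
  -- distributional derivative.
  obtain ⟨c', hc'⟩ := exists_eq_mul_integral (Λ := fun ψ => ∫ x, (k x + c * x) * ψ x ∂unitVol)
    (hlin _ hkx) (fun ψ hψ => by
      simp only [add_mul]
      rw [integral_add (hψ.deriv.integrable_mul hk) (hψ.deriv.integrable_mul hx), hc ψ hψ]
      have h1 := intervalIntegral.integral_eq_sub_of_hasDerivAt (a := 0) (b := 1)
        (f := fun x : ℝ => x * ψ x) (f' := fun x => 1 * ψ x + x * deriv ψ x)
        (fun x _ => (hasDerivAt_id x).mul (hψ.1.differentiable (by simp) x).hasDerivAt)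
        (Continuous.intervalIntegrable (by
          have := hψ.continuous
          have := hψ.deriv.continuous
          fun_prop) _ _)
      have i1 : Integrable (fun x => 1 * ψ x) unitVol :=
        intervalIntegrable_iff_unitVol.1 ((hψ.continuous.const_mul 1).intervalIntegrable 0 1)
      have i2 : Integrable (fun x => x * deriv ψ x) unitVol :=
        intervalIntegrable_iff_unitVol.1
          ((continuous_id.mul hψ.deriv.continuous).intervalIntegrable 0 1)
      rw [hψ.eq_zero (x := 1) (by simp), intervalIntegral_eq_unitVol, integral_add i1 i2] at h1
      simp only [one_mul, mul_zero, zero_mul, sub_zero] at h1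
      simp only [mul_assoc]
      rw [integral_const_mul, ← mul_add, h1, mul_zero])
  refine ⟨c', -c, ?_⟩
  have hcc : Integrable (fun _ : ℝ => c') unitVol := integrable_const c'
  have := ae_eq_zero_of_integral_mul_test (hkx.sub hcc) (fun η hη => by
    simp only [Pi.sub_apply, sub_mul]
    rw [integral_sub (hη.integrable_mul hkx) (hη.integrable_mul hcc), hc' η hη,
      integral_const_mul, sub_self])
  filter_upwards [this] with x hx
  simp only [Pi.sub_apply, Pi.zero_apply] at hx
  linarith

/-! ### Boundary values in the mean -/

lemma tendsto_mean_abs {h : ℝ → ℝ} (hh : ContinuousOn h (Icc 0 1)) :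
    Tendsto (fun ε : ℝ => 1 / ε * ∫ x in (0 : ℝ)..ε, |h x|) (𝓝[>] 0) (𝓝 |h 0|) := by
  -- Clamping the argument to [0,1] extends |h| continuously to the line, and the limit is the
  -- derivative at 0 of its primitive.
  set g : ℝ → ℝ := fun x => |h (max 0 (min 1 x))|
  have hg : Continuous g := (hh.comp_continuous (by fun_prop) (fun x =>
    ⟨le_max_left _ _, max_le zero_le_one (min_le_left _ _)⟩)).abs
  have h1 := (hg.integral_hasStrictDerivAt 0 0).hasDerivAt.tendsto_slope_zero_right
  have hg0 : g 0 = |h 0| := by simp [g]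
  rw [hg0] at h1
  refine h1.congr' ?_
  filter_upwards [Ioo_mem_nhdsGT (zero_lt_one' ℝ)] with ε hε
  rw [zero_add, intervalIntegral.integral_same, sub_zero, smul_eq_mul, one_div]
  congr 1
  refine intervalIntegral.integral_congr fun x hx => ?_
  rw [uIcc_of_le hε.1.le] at hx
  simp [g, min_eq_right (hx.2.trans hε.2.le), max_eq_right hx.1]

lemma mean_reflect (h : ℝ → ℝ) : (fun ε : ℝ => 1 / ε * ∫ x in (1 - ε)..(1 : ℝ), |h x|) =
    fun ε : ℝ => 1 / ε * ∫ x in (0 : ℝ)..ε, |h (1 - x)| := by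
  ext ε
  rw [intervalIntegral.integral_comp_sub_left (fun x => |h x|), sub_zero]

lemma eq_zero_of_tendsto_mean {h u w : ℝ → ℝ} (hh : ContinuousOn h (Icc 0 1))
    (hu : Integrable u unitVol) (hw : Integrable w unitVol)
    (hle : ∀ᵐ x ∂unitVol, |h x| ≤ |w x| + |u x|)
    (hu0 : Tendsto (fun ε : ℝ => 1 / ε * ∫ x in (0 : ℝ)..ε, |u x|) (𝓝[>] 0) (𝓝 0))
    (hw0 : Tendsto (fun ε : ℝ => 1 / ε * ∫ x in (0 : ℝ)..ε, |w x|) (𝓝[>] 0) (𝓝 0)) :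
    h 0 = 0 := by
  refine abs_eq_zero.1 (le_antisymm ?_ (abs_nonneg _))
  refine le_of_tendsto_of_tendsto (tendsto_mean_abs hh)
    (by simpa only [add_zero] using hw0.add hu0) ?_
  filter_upwards [Ioo_mem_nhdsGT (zero_lt_one' ℝ)] with ε hε
  have hsub : Ioo 0 ε ⊆ Ioo (0 : ℝ) 1 := Ioo_subset_Ioo_right hε.2.le
  have iu : IntegrableOn (fun x => |u x|) (Ioo 0 ε) := IntegrableOn.mono_set hu.abs hsub
  have iw : IntegrableOn (fun x => |w x|) (Ioo 0 ε) := IntegrableOn.mono_set hw.abs hsub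
  have ih : IntegrableOn (fun x => |h x|) (Ioo 0 ε) :=
    (hh.abs.integrableOn_Icc).mono_set (hsub.trans Ioo_subset_Icc_self)
  rw [← mul_add]
  refine mul_le_mul_of_nonneg_left ?_ (one_div_nonneg.2 hε.1.le)
  simp only [intervalIntegral.integral_of_le hε.1.le, integral_Ioc_eq_integral_Ioo]
  rw [← integral_add iw iu]
  exact integral_mono_ae ih (iw.add iu) (ae_mono (Measure.restrict_mono hsub le_rfl) hle)

lemma integrable_comp_one_sub {g : ℝ → ℝ} (hg : Integrable g unitVol) :
    Integrable (fun x => g (1 - x)) unitVol := by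
  have := (intervalIntegrable_iff_unitVol.2 hg).comp_sub_left 1
  rw [sub_self, sub_zero] at this
  exact intervalIntegrable_iff_unitVol.1 this.symm

lemma ae_comp_one_sub {p : ℝ → Prop} (h : ∀ᵐ x ∂unitVol, p x) : ∀ᵐ x ∂unitVol, p (1 - x) := by
  rw [ae_restrict_iff' measurableSet_Ioo] at h ⊢
  have h1 : ∀ᵐ x : ℝ, (1 - x) ∈ Ioo (0 : ℝ) 1 → p (1 - x) :=
    (Measure.measurePreserving_sub_left volume (1 : ℝ)).quasiMeasurePreserving.ae h
  filter_upwards [h1] with x hx hxI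
  exact hx ⟨by linarith [hxI.2], by linarith [hxI.1]⟩

/-! ### Uniqueness of very weak solutions -/

lemma one_le_rho {a b x : ℝ} (ha : a ≤ 0) (hb : b ≤ 0) (hx : x ∈ Ioo (0 : ℝ) 1) :
    1 ≤ rho a b x :=
  one_le_mul_of_one_le_of_one_le
    (Real.one_le_rpow_of_pos_of_le_one_of_nonpos (by linarith [hx.2]) (by linarith [hx.1]) ha)
    (Real.one_le_rpow_of_pos_of_le_one_of_nonpos hx.1 hx.2.le hb)

/-- Very weak solutions are unique. -/
lemma IsWeakSolution.ae_eq {α r a b : ℝ} (hα₁ : 1 < α) (hα₂ : α < 2) (hr₀ : 0 ≤ r)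
    (hr₁ : r ≤ 1) (h : Balanced α r a b) {f w u : ℝ → ℝ} (hw : IsWeakSolution α r f w)
    (hu : IsWeakSolution α r f u) : w =ᵐ[unitVol] u := by
  obtain ⟨hwi, hw0, hw1, hwe⟩ := hw
  obtain ⟨hui, hu0, hu1, hue⟩ := hu
  replace hwi : Integrable w unitVol := hwi
  replace hui : Integrable u unitVol := hui
  obtain ⟨ha, ha1, hb, hb1, hab, -⟩ := id h
  set v : ℝ → ℝ := fun t => w t + (-1) * u t
  have hvi : Integrable v unitVol := hwi.add (hui.const_mul (-1))
  have hkv : kint α r v =ᵐ[unitVol] fun x => mixedInt α r w x - mixedInt α r u x := by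
    filter_upwards [kint_add_ae hα₁ hα₂ r hwi (hui.const_mul (-1)),
      mixedInt_ae_eq_kint hα₁ hα₂ r hwi, mixedInt_ae_eq_kint hα₁ hα₂ r hui] with x h1 h2 h3
    rw [h1, h2, h3, kint_const_mul]
    ring
  have hmw := (integrable_kint hα₁ hα₂ r hwi).congr (mixedInt_ae_eq_kint hα₁ hα₂ r hwi).symm
  have hmu := (integrable_kint hα₁ hα₂ r hui).congr (mixedInt_ae_eq_kint hα₁ hα₂ r hui).symm
  obtain ⟨c₀, c₁, hc⟩ := ae_eq_affine_of_integral_mul_deriv_deriv (integrable_kint hα₁ hα₂ r hvi)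
    (fun ψ hψ => by
      have h1 := hwe ψ hψ
      rw [← hue ψ hψ, neg_inj, intervalIntegral_eq_unitVol, intervalIntegral_eq_unitVol,
        ← sub_eq_zero, ← integral_sub (hψ.deriv.deriv.integrable_mul hmw)
        (hψ.deriv.deriv.integrable_mul hmu)] at h1
      rw [← h1]
      refine integral_congr_ae ?_
      filter_upwards [hkv] with x hx
      rw [hx, sub_mul])
  obtain ⟨C, hC0, hC⟩ := kint_rho_eq_const hα₁ hα₂ hr₀ hr₁ h
  obtain ⟨J, hJ, hJn⟩ := exists_linearMap_kint hα₁ hα₂ ha hb hC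
  -- The bound 2 keeps the preimage affine, so two boundary values will determine it.
  obtain ⟨d, hd, hd'⟩ := exists_map_eq_of_triangular J _
    (fun n => (mul_pos hC0 (leadCoef_pos hα₁ n)).ne') hJn 2
    (Polynomial.C c₀ + Polynomial.C c₁ * Polynomial.X) (fun k hk => by
      simp [Polynomial.coeff_C_of_ne_zero (show k ≠ 0 by omega), Polynomial.coeff_X,
        show 1 ≠ k by omega])
  have hφd : Integrable (fun t => rho (a - 1) (b - 1) t * d.eval t) unitVol :=
    (integrable_rho ha hb).mul_continuous_unitVol d.continuous.continuousOn
  have hvd : v =ᵐ[unitVol] fun t => rho (a - 1) (b - 1) t * d.eval t := by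
    have := ae_eq_zero_of_kint_ae_eq_zero hα₁ hα₂ hr₀ hr₁ h
      (g := fun t => v t + (-1) * (rho (a - 1) (b - 1) t * d.eval t))
      (hvi.add (hφd.const_mul (-1))) (by
        filter_upwards [kint_add_ae hα₁ hα₂ r hvi (hφd.const_mul (-1)), hc, hJ d] with x h1 h2 h3
        rw [h1, h2, kint_const_mul, h3, hd']
        simp)
    filter_upwards [this] with x hx
    simp only [Pi.zero_apply] at hx
    linarith
  -- The weight is at least 1 because a, b ≤ 1, so dropping it keeps an upper bound on |d| and
  -- transfers the mean boundary conditions to d.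
  have hle : ∀ᵐ x ∂unitVol, |d.eval x| ≤ |w x| + |u x| := by
    filter_upwards [hvd, ae_restrict_mem measurableSet_Ioo] with x h1 hx
    have h2 := one_le_rho (a := a - 1) (b := b - 1) (by linarith) (by linarith) hx
    calc |d.eval x| ≤ rho (a - 1) (b - 1) x * |d.eval x| := le_mul_of_one_le_left (abs_nonneg _) h2
      _ = |v x| := by rw [h1, abs_mul, abs_of_nonneg (by linarith : 0 ≤ rho (a - 1) (b - 1) x)]
      _ ≤ |w x| + |u x| := by
        simp only [v, neg_one_mul, ← sub_eq_add_neg]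
        exact abs_sub _ _
  have h0 : d.eval 0 = 0 :=
    eq_zero_of_tendsto_mean (h := fun x => d.eval x) d.continuous.continuousOn hui hwi hle hu0 hw0
  have h1 : d.eval 1 = 0 := by
    rw [mean_reflect] at hu1 hw1
    simpa using eq_zero_of_tendsto_mean (h := fun x => d.eval (1 - x))
      (d.continuous.comp (continuous_const.sub continuous_id)).continuousOn
      (integrable_comp_one_sub hui) (integrable_comp_one_sub hwi) (ae_comp_one_sub hle) hu1 hw1
  have hdeg : d.natDegree < 2 := by
    rw [Nat.lt_succ_iff, Polynomial.natDegree_le_iff_coeff_eq_zero]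
    exact hd
  have hdz : ∀ x, d.eval x = 0 := fun x => by
    rw [Polynomial.eval_eq_sum_range' hdeg] at h0 h1 ⊢
    simp only [Finset.sum_range_succ, Finset.sum_range_zero, zero_add, pow_zero, pow_one,
      mul_one, mul_zero, add_zero] at h0 h1 ⊢
    rw [h0] at h1 ⊢
    rw [zero_add] at h1
    rw [h1]
    ring
  filter_upwards [hvd] with x hx
  rw [hdz] at hx
  simp only [v] at hx
  linarith

lemma IsSolution.isWeakSolution {α r : ℝ} (hα₁ : 1 < α) (hα₂ : α < 2) {f u : ℝ → ℝ}
    (hu : IsSolution α r f u) : IsWeakSolution α r f u := by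
  obtain ⟨hac, hu0, hu1, hue⟩ := hu
  have hc : ContinuousOn u (Icc 0 1) := by
    rw [← uIcc_of_le (zero_le_one' ℝ)]; exact hac.continuousOn
  refine ⟨hc.integrableOn_Icc.mono_set Ioo_subset_Icc_self, ?_, ?_, fun ψ hψ => ?_⟩
  · simpa [hu0] using tendsto_mean_abs hc
  · rw [mean_reflect]
    have : ContinuousOn (fun x => u (1 - x)) (Icc 0 1) := hc.comp (by fun_prop)
      fun x hx => ⟨by linarith [hx.2], by linarith [hx.1]⟩
    simpa [hu1] using tendsto_mean_abs this
  · rw [integral_mixedInt_mul_deriv_deriv hα₁ hα₂ r hac hu0 hu1 hψ, hue ψ hψ]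

end FracDiff

end

theorem mainTheorem10 (α r β s : ℝ) (hα₁ : 1 < α) (hα₂ : α < 2) (hr₀ : 0 ≤ r) (hr₁ : r ≤ 1)
    (hβ : FracDiff.ConditionA α r β) (hs : (1 - α) + max (α - β) β < s)
    (f : ℝ → ℝ) (hf : FracDiff.MemH s β (α - β) f) :
    ∃ u : ℝ → ℝ,
      ContinuousOn u (Icc 0 1) ∧
      FracDiff.IsSolution α r f u ∧
      (∀ w : ℝ → ℝ, FracDiff.IsSolution α r f w → EqOn w u (Icc 0 1)) ∧
      FracDiff.IsWeakSolution α r f u ∧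
      (∀ w : ℝ → ℝ, FracDiff.IsWeakSolution α r f w →
        w =ᵐ[volume.restrict (Ioo 0 1)] u) := by
  have hbal := hβ.balanced hα₁ hα₂
  obtain ⟨u, hu⟩ := FracDiff.exists_isSolution hα₁ hα₂ hr₀ hr₁ hbal hf.1
  have hcont : ∀ w, FracDiff.IsSolution α r f w → ContinuousOn w (Icc 0 1) := fun w hw => by
    rw [← uIcc_of_le (zero_le_one' ℝ)]
    exact hw.1.continuousOn
  have hweak := hu.isWeakSolution hα₁ hα₂
  have huniq : ∀ w, FracDiff.IsWeakSolution α r f w → w =ᵐ[volume.restrict (Ioo 0 1)] u :=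
    fun w hw => hw.ae_eq hα₁ hα₂ hr₀ hr₁ hbal hweak
  refine ⟨u, hcont u hu, hu, fun w hw => ?_, hweak, huniq⟩
  -- Uniqueness almost everywhere improves to equality on [0,1], end points included, because both
  -- solutions are continuous there.
  have h := huniq w (hw.isWeakSolution hα₁ hα₂)
  rw [Measure.restrict_congr_set Ioo_ae_eq_Icc] at h
  exact Measure.eqOn_Icc_of_ae_eq volume zero_ne_one h (hcont w hw) (hcont u hu)
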